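/- Let $\mathbf{k}$ be an algebraically closed field of characteristic $0$, let $n\ge 2$, and let $X\subset \mathbb{P}^N_{\mathbf{k}}$ be a closed subscheme of pure dimension $n$ all of whose local rings are Cohen--Macaulay, with $H^i(\mathbb{P}^N,\mathcal{I}_{X,\mathbb{P}^N}(t))=0$ for all $t\in\mathbb{Z}$ and all $1\le i\le n-1$. Let $Y$ be an irreducible component of $X_{\mathrm{red}}$ (with its reduced structure). Say that $Y$ has multiplicity $1$ in $X$ if there is a non-empty open subset $U\subseteq Y$ with $\mathcal{O}_{X,x}=\mathcal{O}_{Y,x}$ for all $x\in U$, and that $Y$ has multiplicity $>1$ otherwise. Fix an integer $e>0$. For an integral divisor $C\in|\mathcal{O}_Y(e)|$ (the integral zero scheme in $Y$ of a nonzero section of $\mathcal{O}_Y(e)$) let $\mathcal{I}_{C,X}\subset\mathcal{O}_X$ be the ideal sheaf of $C$ in $X$ and $$\Sigma_C:=\{p\in Y \mid \mathcal{I}_{C,X}\text{ is not locally free at }p\}.$$ (i) Suppose that $Y$ has multiplicity $>1$ in $X$. Then $\Sigma_C=C$ as sets for every integral $C\in|\mathcal{O}_Y(e)|$, i.e. $\mathcal{I}_{C,X}$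 is locally free at no point of $C$ and is locally free at every point of $Y\setminus C$. For integral $C_1,C_2\in|\mathcal{O}_Y(e)|$ we have $\mathcal{I}_{C_1,X}\cong\mathcal{I}_{C_2,X}$ as $\mathcal{O}_X$-modules if and only if $C_1=C_2$. (ii) Suppose that $Y$ has multiplicity $1$ in $X$ and that $X$ is not integral. Let $F$ be the scheme-theoretic intersection of $Y$ with the union of the other components of $X$, counted with their multiplicities (that is, with the scheme-theoretic closure of $X\setminus Y$ in $X$). Then $F\neq\emptyset$, $F$ has pure dimension $n-1$, and for every integral $C\in|\mathcal{O}_Y(e)|$ we have $F\cap C\neq\emptyset$ and $\Sigma_C=(F\cap C)_{\mathrm{red}}$. (iii) For any integral $C_1,C_2\in|\mathcal{O}_Y(e)|$ with $\mathcal{I}_{C_1,X}\cong\mathcal{I}_{C_2,X}$ we have $\Sigma_{C_1}=\Sigma_{C_2}$. If $Y$ has multiplicity $>1$ in $X$, then conversely $\Sigma_{C_1}=\Sigma_{C_2}$ implies $\mathcal{I}_{C_1,X}\cong\mathcal{I}_{C_2,X}$. -/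

import Mathlib

open CategoryTheory AlgebraicGeometry TopologicalSpace Opposite

universe u

namespace ACM

noncomputable section

/-! ### Projective space, its coordinate charts and the twists of a sheaf of modules -/

attribute [local instance] MvPolynomial.gradedAlgebra

/-- Projective space `ℙ^N` over `k`, as `Proj k[X_0, …, X_N]`. -/
abbrev ProjSpace (k : Type u) [Field k] (N : ℕ) : Scheme.{u} :=
  Proj (MvPolynomial.homogeneousSubmodule (Fin (N + 1)) k)

/-- The standard open subset `X_j ≠ 0` of `ℙ^N`. -/
def coordOpen (k : Type u) [Field k] (N : ℕ) (j : Fin (N + 1)) : (ProjSpace k N).Opens :=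
  Proj.basicOpen (MvPolynomial.homogeneousSubmodule (Fin (N + 1)) k) (MvPolynomial.X j)

/-- The regular function `X_l / X_j` on the open subset `X_j ≠ 0` of `ℙ^N`. -/
def coordRatio (k : Type u) [Field k] (N : ℕ) (j l : Fin (N + 1)) :
    Γ(ProjSpace k N, coordOpen k N j) :=
  (Proj.awayToSection (MvPolynomial.homogeneousSubmodule (Fin (N + 1)) k)
    (MvPolynomial.X j)).hom
    (HomogeneousLocalization.Away.mk (MvPolynomial.homogeneousSubmodule (Fin (N + 1)) k)
      (d := 1) (MvPolynomial.isHomogeneous_X k j) 1 (MvPolynomial.X l)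
      (MvPolynomial.isHomogeneous_X k l))

variable {k : Type u} [Field k] {N : ℕ} {Z : Scheme.{u}}

/-- The preimage in `Z` of the standard open subset `X_j ≠ 0`. -/
def chart (f : Z ⟶ ProjSpace k N) (j : Fin (N + 1)) : Z.Opens :=
  f ⁻¹ᵁ coordOpen k N j

/-- The function `X_l / X_j` on the part of `Z` where `X_j ≠ 0`. -/
def ratio (f : Z ⟶ ProjSpace k N) (j l : Fin (N + 1)) : Γ(Z, chart f j) :=
  (f.app (coordOpen k N j)).hom (coordRatio k N j l)

/-- Restriction of sections of a sheaf of modules. -/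
def res (M : Z.Modules) {U V : Z.Opens} (h : V ≤ U) : Γ(M, U) →+ Γ(M, V) :=
  (M.presheaf.map (homOfLE h).op).hom

/-- The function `X_l / X_j` on an open subset on which `X_j ≠ 0`. -/
def ratioOn (f : Z ⟶ ProjSpace k N) (j l : Fin (N + 1)) {W : Z.Opens} (h : W ≤ chart f j) :
    Γ(Z, W) :=
  (Z.presheaf.map (homOfLE h).op).hom (ratio f j l)

/-- Sections over `U` of the twist `M(t) = M ⊗ 𝒪(t)`, where `𝒪(t)` is the pullback to `Z` of
`𝒪_{ℙ^N}(t)`. A section is written `s_j ⊗ X_j ^ t` on the part of `U` where `X_j ≠ 0`; such a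
family `(s_j)` is a section of `M(t)` when `s_j = (X_l / X_j) ^ t • s_l` on all overlaps. For
`t < 0` this relation is written `(X_l / X_j) ^ (-t) • s_j = s_l`. -/
def twistSections (f : Z ⟶ ProjSpace k N) (M : Z.Modules) (t : ℤ) (U : Z.Opens) :
    AddSubgroup (∀ j : Fin (N + 1), Γ(M, U ⊓ chart f j)) where
  carrier := {s | ∀ j l : Fin (N + 1),
    ratioOn f j l (W := U ⊓ (chart f j ⊓ chart f l)) (inf_le_right.trans inf_le_left)
        ^ t.toNat •
      res M (V := U ⊓ (chart f j ⊓ chart f l)) (inf_le_inf_left U inf_le_right) (s l) =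
    ratioOn f j l (W := U ⊓ (chart f j ⊓ chart f l)) (inf_le_right.trans inf_le_left)
        ^ (-t).toNat •
      res M (V := U ⊓ (chart f j ⊓ chart f l)) (inf_le_inf_left U inf_le_left) (s j)}
  zero_mem' := fun j l ↦ by simp
  add_mem' := fun {a b} ha hb j l ↦ by
    simp only [Pi.add_apply, map_add, smul_add]
    rw [ha j l, hb j l]
  neg_mem' := fun {a} ha j l ↦ by
    simp only [Pi.neg_apply, map_neg, smul_neg]
    rw [ha j l]

lemma res_res (M : Z.Modules) {U V W : Z.Opens} (h : V ≤ U) (h' : W ≤ V) (x : Γ(M, U)) :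
    res M h' (res M h x) = res M (h'.trans h) x := by
  have := M.presheaf.map_comp (homOfLE h).op (homOfLE h').op
  exact (ConcreteCategory.congr_hom this x).symm

lemma res_smul (M : Z.Modules) {U V : Z.Opens} (h : V ≤ U) (r : Γ(Z, U)) (x : Γ(M, U)) :
    res M h (r • x) = (Z.presheaf.map (homOfLE h).op).hom r • res M h x :=
  Scheme.Modules.map_smul M (homOfLE h) r x

lemma map_ratioOn (f : Z ⟶ ProjSpace k N) (j l : Fin (N + 1)) {V W : Z.Opens}
    (h : W ≤ chart f j) (h' : V ≤ W) :
    (Z.presheaf.map (homOfLE h').op).hom (ratioOn f j l h) = ratioOn f j l (h'.trans h) := by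
  have := Z.presheaf.map_comp (homOfLE h).op (homOfLE h').op
  exact (ConcreteCategory.congr_hom this (ratio f j l)).symm

/-- The two sides of the gluing relation, on an arbitrary open subset of the overlap. -/
lemma rel_res (f : Z ⟶ ProjSpace k N) (M : Z.Modules) (t : ℕ) {V W W' : Z.Opens}
    (j l : Fin (N + 1)) (hW : W ≤ chart f j) (hV : W ≤ V) (hW' : W' ≤ W) (x : Γ(M, V)) :
    res M hW' (ratioOn f j l hW ^ t • res M hV x) =
      ratioOn f j l (hW'.trans hW) ^ t • res M (hW'.trans hV) x := by
  rw [res_smul, map_pow, map_ratioOn, res_res]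

/-- Restriction maps of the twist. -/
def twistRes (f : Z ⟶ ProjSpace k N) (M : Z.Modules) (t : ℤ) {U V : Z.Opens} (h : V ≤ U) :
    twistSections f M t U →+ twistSections f M t V where
  toFun s := ⟨fun j ↦ res M (inf_le_inf_right _ h) (s.1 j), fun j l ↦ by
    have := congrArg (res M (V := V ⊓ (chart f j ⊓ chart f l)) (inf_le_inf_right _ h))
      (s.2 j l)
    rw [rel_res, rel_res] at this
    rw [res_res, res_res]
    exact this⟩
  map_zero' := by ext j; simp
  map_add' a b := by ext j; simp

/-- The presheaf of sections of the twist `M(t)`. -/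
def twistPresheaf (f : Z ⟶ ProjSpace k N) (M : Z.Modules) (t : ℤ) :
    TopCat.Presheaf Ab.{u} Z where
  obj U := AddCommGrpCat.of (twistSections f M t U.unop)
  map i := AddCommGrpCat.ofHom (twistRes f M t i.unop.le)
  map_id U := by
    ext s j
    exact ConcreteCategory.congr_hom (M.presheaf.map_id _) (s.1 j)
  map_comp {U V W} i i' := by
    ext s j
    exact (res_res M _ _ (s.1 j)).symm

lemma res_ext (M : Z.Modules) {ι : Type u} {U : Z.Opens} (V : ι → Z.Opens)
    (hV : ∀ i, V i ≤ U) (hU : U ≤ iSup V) {x y : Γ(M, U)}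
    (h : ∀ i, res M (hV i) x = res M (hV i) y) : x = y :=
  TopCat.Sheaf.eq_of_locally_eq' ⟨M.presheaf, M.isSheaf⟩ V U (fun i ↦ homOfLE (hV i)) hU x y h

lemma twistPresheaf_isSheaf (f : Z ⟶ ProjSpace k N) (M : Z.Modules) (t : ℤ) :
    (twistPresheaf f M t).IsSheaf := by
  rw [TopCat.Presheaf.isSheaf_iff_isSheafUniqueGluing]
  intro ι U sf hsf
  have hcov : ∀ W : Z.Opens, iSup U ⊓ W ≤ ⨆ i, U i ⊓ W := fun W ↦ by rw [iSup_inf_eq]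
  have hle : ∀ (W : Z.Opens) (i : ι), U i ⊓ W ≤ iSup U ⊓ W :=
    fun W i ↦ inf_le_inf_right _ (le_iSup U i)
  have key : ∀ j, ∃! s : Γ(M, iSup U ⊓ chart f j), ∀ i, res M (hle _ i) s = (sf i).1 j := by
    intro j
    refine TopCat.Sheaf.existsUnique_gluing' ⟨M.presheaf, M.isSheaf⟩ (fun i ↦ U i ⊓ chart f j)
      (iSup U ⊓ chart f j) (fun i ↦ homOfLE (hle _ i)) (hcov _) (fun i ↦ (sf i).1 j) ?_
    intro a b
    have h1 := congrArg (fun s ↦ s.1 j) (hsf a b)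
    have h2 := congrArg (res M (V := (U a ⊓ chart f j) ⊓ (U b ⊓ chart f j))
      (le_inf (le_inf (inf_le_left.trans inf_le_left) (inf_le_right.trans inf_le_left))
        (inf_le_left.trans inf_le_right))) h1
    exact (res_res M _ _ _).symm.trans (h2.trans (res_res M _ _ _))
  choose s hs hs' using key
  refine ⟨⟨s, fun j l ↦ ?_⟩, fun i ↦ Subtype.ext (funext fun j ↦ hs j i), ?_⟩
  · refine res_ext M (fun i ↦ U i ⊓ (chart f j ⊓ chart f l)) (hle _) (hcov _) fun i ↦ ?_
    rw [rel_res, rel_res]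
    have := (sf i).2 j l
    rw [← hs j i, ← hs l i, res_res, res_res] at this
    exact this
  · intro s' h'
    refine Subtype.ext (funext fun j ↦ hs' j _ fun i ↦ ?_)
    exact congrArg (fun s ↦ s.1 j) (h' i)

/-- The underlying sheaf of abelian groups of the twist `M(t) = M ⊗ 𝒪(t)`. -/
def twist (f : Z ⟶ ProjSpace k N) (M : Z.Modules) (t : ℤ) :
    Sheaf (Opens.grothendieckTopology Z) Ab.{u} :=
  ⟨twistPresheaf f M t, twistPresheaf_isSheaf f M t⟩

/-! ### Structure sheaf, ideal sheaves, local freeness -/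

/-- The structure sheaf as a module over itself. -/
def structureModule (Z : Scheme.{u}) : Z.Modules := SheafOfModules.unit Z.ringCatSheaf

/-- The morphism `𝒪_X ⟶ f_* 𝒪_Z`. -/
def unitToPushforward {X : Scheme.{u}} (f : Z ⟶ X) :
    structureModule X ⟶ (Scheme.Modules.pushforward f).obj (structureModule Z) :=
  SheafOfModules.unitToPushforwardObjUnit f.toRingCatSheafHom

/-- The ideal sheaf `I_{Z,X}` of a closed subscheme `f : Z ⟶ X`, as an `𝒪_X`-module: the kernel
of `𝒪_X ⟶ f_* 𝒪_Z`. -/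
def idealModule {X : Scheme.{u}} (f : Z ⟶ X) : X.Modules :=
  Limits.kernel (unitToPushforward f)

/-- `M` is locally free (of finite rank) at `p`: it is free on an open neighbourhood of `p`. -/
def IsLocallyFreeAt {X : Scheme.{u}} (M : X.Modules) (p : X) : Prop :=
  ∃ U : X.Opens, p ∈ U ∧ ∃ r : ℕ,
    Nonempty (M.restrict U.ι ≅
      (SheafOfModules.free (R := U.toScheme.ringCatSheaf) (ULift.{u} (Fin r)) :
        U.toScheme.Modules))

/-! ### Dimension, depth, arithmetically Cohen–Macaulay subschemes -/

/-- Every irreducible component of `T` has dimension `n`. -/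
def IsPureDim (T : Type u) [TopologicalSpace T] (n : ℕ) : Prop :=
  ∀ W ∈ irreducibleComponents T, topologicalKrullDim W = n

/-- The depth of a local ring: the supremum of the lengths of the regular sequences contained in
the maximal ideal. -/
def depth (R : Type u) [CommRing R] [IsLocalRing R] : ℕ∞ :=
  ⨆ rs : {rs : List R // (∀ r ∈ rs, r ∈ IsLocalRing.maximalIdeal R) ∧
    RingTheory.Sequence.IsRegular R rs}, (rs.1.length : ℕ∞)

/-- All local rings of `X` are Cohen–Macaulay. -/
def IsCohenMacaulay (X : Scheme.{u}) : Prop :=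
  ∀ x : X, ((depth (X.presheaf.stalk x) : ℕ∞) : WithBot ℕ∞) = ringKrullDim (X.presheaf.stalk x)

/-- The closed subscheme `f : X ⟶ ℙ^N` of dimension `n` satisfies `H^i(ℙ^N, I_X(t)) = 0` for all
`t ∈ ℤ` and `1 ≤ i ≤ n - 1`. -/
def HasACMVanishing {X : Scheme.{u}} (f : X ⟶ ProjSpace k N) (n : ℕ) : Prop :=
  ∀ (t : ℤ) (i : ℕ), 1 ≤ i → i ≤ n - 1 →
    Subsingleton ((twist (𝟙 (ProjSpace k N)) (idealModule f) t).H i)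

/-! ### Components, divisors, and the loci of the statement -/

section Component

variable {X : Scheme.{u}} (Y : Closeds X)

/-- The closed subset `Y` of `X` with its reduced structure. -/
abbrev reducedScheme : Scheme.{u} := (Scheme.IdealSheafData.vanishingIdeal Y).subscheme

/-- The inclusion of `Y`, with its reduced structure, in `X`. -/
abbrev reducedι : reducedScheme Y ⟶ X := (Scheme.IdealSheafData.vanishingIdeal Y).subschemeι

/-- `Y` has multiplicity one in `X`: `𝒪_{X,x} = 𝒪_{Y,x}` for all `x` in a non-empty open subset
of `Y`. -/
def HasMultiplicityOne : Prop :=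
  ∃ U : (reducedScheme Y).Opens, (∃ x, x ∈ U) ∧
    ∀ x ∈ U, Function.Bijective ((reducedι Y).stalkMap x).hom

/-- The scheme-theoretic intersection of `Y` with the union of the other components of `X`,
the latter taken with the structure that they have in `X`, that is, with the scheme-theoretic
closure of `X ∖ Y` in `X`. -/
def residualIntersection : X.IdealSheafData :=
  Scheme.IdealSheafData.vanishingIdeal Y ⊔ (Scheme.Opens.ι (X := X) Y.compl).ker

/-- The inclusion in `X` of a closed subscheme `C` of `Y`. -/
abbrev divisorι (C : (reducedScheme Y).IdealSheafData) : C.subscheme ⟶ X :=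
  C.subschemeι ≫ reducedι Y

/-- `Σ_C`, the set of points of `Y` at which the ideal sheaf `I_{C,X}` is not locally free. -/
def nonLocallyFreeLocus (C : (reducedScheme Y).IdealSheafData) : Set X :=
  {p | p ∈ Y ∧ ¬ IsLocallyFreeAt (idealModule (divisorι Y C)) p}

end Component

/-- `C` belongs to the complete linear system `|𝒪_Z(e)|`: it is the zero scheme of a nonzero
section `s` of `𝒪_Z(e)`, i.e. where `X_j ≠ 0` its ideal is generated by the function `s_j`
(with `s = s_j X_j ^ e`). The scheme `Z` is meant to be integral. -/
def MemLinearSystem (f : Z ⟶ ProjSpace k N) (e : ℤ) (C : Z.IdealSheafData) : Prop :=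
  ∃ s : twistSections f (structureModule Z) e ⊤, s ≠ 0 ∧
    ∀ (j : Fin (N + 1)) (V : Z.affineOpens) (h : V.1 ≤ ⊤ ⊓ chart f j),
      C.ideal V = Ideal.span {(Z.presheaf.map (homOfLE h).op).hom (s.1 j : Γ(Z, ⊤ ⊓ chart f j))}

end

end ACM

/-!
Locally on `X` let `P` be the ideal of `Y` and `J` that of `C`, so that `P ⊊ J`. If `J` is free at
a point of `C`, it is generated by a single `a ∉ P`; as `P` is prime, `P = aP`, and `P` vanishes
near that point by Krull's theorem, which makes `Y` of multiplicity one. In the multiplicity one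
case Cohen–Macaulayness excludes embedded components, so `P` vanishes exactly off the other
components and `Σ_C = F ∩ C`. A Cohen–Macaulay local ring of dimension at least two has connected
punctured spectrum (Hartshorne), so `F` has pure codimension one in `Y`; it is non-empty because
`H¹(I_X) = 0` makes `X` connected, and it meets `C` because a closed subset avoiding an ample
divisor is affine, hence finite.
-/

namespace ACM

noncomputable section

section KrullDimension

section IntegralExtension

variable {R S : Type*} [CommRing R] [CommRing S] [Algebra R S] [Algebra.IsIntegral R S]

variable (R S) in
lemma ringKrullDim_le_of_isIntegral : ringKrullDim S ≤ ringKrullDim R :=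
  Order.krullDim_le_of_strictMono (PrimeSpectrum.comap (algebraMap R S))
    fun _ _ h ↦ Ideal.IsIntegral.comap_lt_comap (R := R) h

lemma ringKrullDim_le_of_isIntegral_of_injective (h : Function.Injective (algebraMap R S)) :
    ringKrullDim R ≤ ringKrullDim S := by
  refine iSup_le fun l ↦ ?_
  obtain ⟨Q, -, _, hQ⟩ := Ideal.exists_ideal_over_prime_of_isIntegral l.head.asIdeal (⊥ : Ideal S)
    fun x hx ↦ by simp [(injective_iff_map_eq_zero _).1 h x hx]
  have : Q.LiesOver l.head.asIdeal := ⟨hQ.symm⟩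
  obtain ⟨L, hL, -⟩ := Ideal.exists_ltSeries_of_hasGoingUp l Q
  rw [← hL]
  exact le_iSup (fun L : LTSeries (PrimeSpectrum S) ↦ (L.length : WithBot ℕ∞)) L

lemma ringKrullDim_eq_of_isIntegral_of_injective (h : Function.Injective (algebraMap R S)) :
    ringKrullDim S = ringKrullDim R :=
  (ringKrullDim_le_of_isIntegral R S).antisymm (ringKrullDim_le_of_isIntegral_of_injective h)

end IntegralExtension

lemma height_eq_of_isMaximal_mvPolynomial {k : Type*} [Field k] {d : ℕ}
    (m : Ideal (MvPolynomial (Fin d) k)) [m.IsMaximal] : m.height = d := by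
  induction d with
  | zero =>
    have h := Ideal.height_le_ringKrullDim_of_ne_top (‹m.IsMaximal›.ne_top)
    simpa using h
  | succ d ih =>
    let e := (MvPolynomial.finSuccEquiv k d).toRingEquiv
    have : (m.map e).IsMaximal := Ideal.map_isMaximal_of_equiv e
    let p := (m.map e).comap (Polynomial.C : MvPolynomial (Fin d) k →+* _)
    have : p.IsMaximal := Polynomial.isMaximal_comap_C_of_isJacobsonRing (m.map e)
    have : (m.map e).LiesOver p := ⟨rfl⟩
    rw [← e.height_map m, Polynomial.height_eq_height_add_one p (m.map e), ih p, Nat.cast_succ]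

lemma ringKrullDim_mvPolynomial_le_quotient_add_one {k : Type*} [Field k] {d : ℕ}
    (q : Ideal (MvPolynomial (Fin d) k)) [q.IsPrime] (hq : q.height ≤ 1) :
    (d : WithBot ℕ∞) ≤ ringKrullDim (MvPolynomial (Fin d) k ⧸ q) + 1 := by
  obtain ⟨a, haq⟩ : q.IsPrincipal := by
    rcases hq.lt_or_eq with h0 | h1
    · rw [Ideal.height_eq_zero_iff_eq_bot.1 (Order.lt_one_iff.1 h0)]
      exact bot_isPrincipal
    · exact UniqueFactorizationMonoid.isPrincipal_of_height_eq_one h1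
  obtain ⟨m, _, hqm⟩ := Ideal.exists_le_maximal q ‹q.IsPrime›.ne_top
  have h := Ideal.height_le_ringKrullDim_quotient_add_one
    (hqm (haq ▸ Submodule.mem_span_singleton_self a))
  rw [height_eq_of_isMaximal_mvPolynomial] at h
  rw [haq]
  exact_mod_cast h

variable (k : Type u) {B B' : Type u} [Field k] [CommRing B] [IsDomain B] [Algebra k B]
  [Algebra.FiniteType k B]

lemma exists_isIntegral_mvPolynomial (B : Type u) [CommRing B] [Nontrivial B] [Algebra k B]
    [Algebra.FiniteType k B] :
    ∃ (d : ℕ) (_ : Algebra (MvPolynomial (Fin d) k) B),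
      IsScalarTower k (MvPolynomial (Fin d) k) B ∧ Algebra.IsIntegral (MvPolynomial (Fin d) k) B ∧
        FaithfulSMul (MvPolynomial (Fin d) k) B := by
  obtain ⟨d, g, hg, hi⟩ := exists_integral_inj_algHom_of_fg k B
  algebraize [g.toRingHom]
  exact ⟨d, inferInstance, .of_algebraMap_eq fun x ↦ (g.commutes x).symm, ⟨hi⟩,
    (faithfulSMul_iff_algebraMap_injective _ _).2 hg⟩

lemma ringKrullDim_eq_toENat_trdeg :
    ringKrullDim B = (Algebra.trdeg k B).toENat := by
  obtain ⟨d, _, _, _, _⟩ := exists_isIntegral_mvPolynomial k B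
  rw [ringKrullDim_eq_of_isIntegral_of_injective
    (FaithfulSMul.algebraMap_injective (MvPolynomial (Fin d) k) B),
    ← trdeg_add_eq k (MvPolynomial (Fin d) k) (A := B)]
  simp [trdeg_eq_zero]

lemma ringKrullDim_eq_of_isAlgebraic [CommRing B'] [IsDomain B'] [Algebra k B']
    [Algebra.FiniteType k B'] [Algebra B B'] [IsScalarTower k B B'] [FaithfulSMul B B']
    [Algebra.IsAlgebraic B B'] : ringKrullDim B' = ringKrullDim B := by
  rw [ringKrullDim_eq_toENat_trdeg k (B := B'), ringKrullDim_eq_toENat_trdeg k (B := B),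
    ← trdeg_add_eq k B (A := B'), trdeg_eq_zero (R := B) (A := B'), add_zero]

lemma ringKrullDim_eq_of_isLocalization_away [CommRing B'] [Algebra k B'] [Algebra B B']
    [IsScalarTower k B B'] {h : B} (hh : h ≠ 0) [IsLocalization.Away h B'] :
    ringKrullDim B' = ringKrullDim B := by
  have hM : Submonoid.powers h ≤ nonZeroDivisors B := powers_le_nonZeroDivisors_of_noZeroDivisors hh
  have : IsDomain B' := IsLocalization.isDomain_of_le_nonZeroDivisors B' hM
  have : Algebra.FiniteType B B' := IsLocalization.finiteType_of_monoid_fg (Submonoid.powers h) B'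
  have : Algebra.FiniteType k B' := .trans (S := B) inferInstance inferInstance
  have : Algebra.IsAlgebraic B B' := IsLocalization.isAlgebraic _ (Submonoid.powers h)
  have : FaithfulSMul B B' := (faithfulSMul_iff_algebraMap_injective _ _).2
    (IsLocalization.injective B' hM)
  exact ringKrullDim_eq_of_isAlgebraic k

/- Going down carries the height bound to a Noether normalization, where primes of height one are
principal and all maximal ideals have the same height. -/
lemma ringKrullDim_le_ringKrullDim_quotient_add_one (k : Type u) {B : Type u} [Field k] [CommRing B]
    [IsDomain B] [Algebra k B] [Algebra.FiniteType k B] (p : Ideal B) [p.IsPrime]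
    (hp : p.height ≤ 1) :
    ringKrullDim B ≤ ringKrullDim (B ⧸ p) + 1 := by
  have : IsNoetherianRing B := Algebra.FiniteType.isNoetherianRing k B
  obtain ⟨d, _, _, _, _⟩ := exists_isIntegral_mvPolynomial k B
  let q : Ideal (MvPolynomial (Fin d) k) := p.under _
  have hq : q.height ≤ 1 := by
    rw [Ideal.height_eq_height_add_of_liesOver_of_hasGoingDown q p] at hp
    exact le_self_add.trans hp
  calc
    ringKrullDim B = d := by
      rw [ringKrullDim_eq_of_isIntegral_of_injective
        (FaithfulSMul.algebraMap_injective (MvPolynomial (Fin d) k) B)]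
      simp
    _ ≤ ringKrullDim (MvPolynomial (Fin d) k ⧸ q) + 1 :=
      ringKrullDim_mvPolynomial_le_quotient_add_one q hq
    _ = ringKrullDim (B ⧸ p) + 1 := by
      rw [ringKrullDim_eq_of_isIntegral_of_injective (R := MvPolynomial (Fin d) k ⧸ q) (S := B ⧸ p)
        Ideal.algebraMap_quotient_injective]

end KrullDimension

section Depth

lemma pow_dvd_of_pow_dvd_pow_mul {R : Type*} [CommRing R] {s t : R} (ht : IsSMulRegular R t)
    (hs : ∀ x, t ∣ s * x → t ∣ x) (m n : ℕ) {x : R} (h : t ^ n ∣ s ^ m * x) : t ^ n ∣ x := by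
  have hsm (y : R) (hy : t ∣ s ^ m * y) : t ∣ y := by
    clear h
    induction m with
    | zero => simpa using hy
    | succ m ih => exact ih (hs _ (by rwa [← mul_assoc, ← pow_succ']))
  induction n generalizing x with
  | zero => simp
  | succ n ih =>
    obtain ⟨y, rfl⟩ := hsm x ((dvd_pow_self t n.succ_ne_zero).trans h)
    obtain ⟨z, hz⟩ := h
    have hy : t ^ n ∣ y := ih ⟨z, ht (by simp only [smul_eq_mul]; linear_combination hz)⟩
    exact pow_succ' t n ▸ mul_dvd_mul_left t hy

variable {R : Type u} [CommRing R] [IsLocalRing R]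

lemma depth_eq_zero_of_forall_mul_eq_zero {b : R} (hb : b ≠ 0)
    (h : ∀ r ∈ IsLocalRing.maximalIdeal R, r * b = 0) : depth R = 0 := by
  refine le_antisymm (iSup_le ?_) bot_le
  rintro ⟨_ | ⟨r, rs⟩, hrs, hreg⟩
  · simp
  · have hr := ((RingTheory.Sequence.isWeaklyRegular_cons_iff R r rs).1 hreg.toIsWeaklyRegular).1
    exact absurd (hr (by simpa using h r (hrs r List.mem_cons_self))) hb

lemma depth_eq_zero_of_mem_associatedPrimes [IsNoetherianRing R] {A : Type*} [CommRing A]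
    [Algebra A R] (Q : Ideal A) [Q.IsPrime] [IsLocalization.AtPrime R Q]
    (hQ : Q ∈ associatedPrimes A A) : depth R = 0 := by
  have hass : IsLocalRing.maximalIdeal R ∈ associatedPrimes R R :=
    Module.associatedPrimes.mem_associatedPrimes_of_comap_mem_associatedPrimes_of_isLocalizedModule
      Q.primeCompl (Algebra.linearMap A R) _
      (by rwa [← Ideal.under_def, IsLocalization.AtPrime.under_maximalIdeal R Q])
  obtain ⟨-, y, hy⟩ := isAssociatedPrime_iff.1 hass
  refine depth_eq_zero_of_forall_mul_eq_zero (b := y) ?_ fun r hr ↦ ?_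
  · rintro rfl
    exact (IsLocalRing.maximalIdeal.isMaximal R).ne_top (hy.trans (by simp))
  · rwa [hy, Submodule.mem_colon_singleton] at hr

open Pointwise in
lemma exists_isSMulRegular_and_forall_dvd_of_two_le_depth (h : 2 ≤ depth R) :
    ∃ t ∈ IsLocalRing.maximalIdeal R, ∃ s ∈ IsLocalRing.maximalIdeal R,
      IsSMulRegular R t ∧ ∀ x, t ∣ s * x → t ∣ x := by
  obtain ⟨⟨rs, hrs, hreg⟩, hlen⟩ := lt_iSup_iff.1 (lt_of_lt_of_le (by norm_num : (1 : ℕ∞) < 2) h)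
  match rs, hrs, hreg, hlen with
  | [], _, _, hlen => simp at hlen
  | [_], _, _, hlen => simp at hlen
  | t :: s :: rs, hrs, hreg, _ =>
    have ht := (RingTheory.Sequence.isWeaklyRegular_cons_iff R t (s :: rs)).1 hreg.toIsWeaklyRegular
    have hs := ((RingTheory.Sequence.isWeaklyRegular_cons_iff _ s rs).1 ht.2).1
    have hmem (z : R) : z ∈ t • (⊤ : Submodule R R) ↔ t ∣ z := by
      simp [Submodule.mem_smul_pointwise_iff_exists, dvd_iff_exists_eq_mul_right, eq_comm]
    refine ⟨t, hrs t (by simp), s, hrs s (by simp), ht.1, fun x hx ↦ ?_⟩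
    rw [← hmem, ← Submodule.Quotient.mk_eq_zero] at hx ⊢
    exact hs (by simpa only [smul_zero, ← Submodule.Quotient.mk_smul, smul_eq_mul] using hx)

/- If `t ^ n = i + j` and `s ^ m = i' + j'`, then `s ^ m * i = i * i' = t ^ n * i'`, so regularity
turns `i` into `t ^ n` times an idempotent. -/
lemma eq_bot_or_eq_bot_of_two_le_depth (h : 2 ≤ depth R) {I J : Ideal R} (hIJ : I * J = ⊥)
    (hrad : IsLocalRing.maximalIdeal R ≤ (I ⊔ J).radical) : I = ⊥ ∨ J = ⊥ := by
  obtain ⟨t, ht, s, hs, hreg, hdvd⟩ := exists_isSMulRegular_and_forall_dvd_of_two_le_depth h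
  obtain ⟨n, hn⟩ := hrad ht
  obtain ⟨m, hm⟩ := hrad hs
  obtain ⟨i, hi, j, hj, hij⟩ := Submodule.mem_sup.1 hn
  obtain ⟨i', hi', j', hj', hij'⟩ := Submodule.mem_sup.1 hm
  have hmul {x y : R} (hx : x ∈ I) (hy : y ∈ J) : x * y = 0 := by
    simpa [hIJ] using Ideal.mul_mem_mul hx hy
  have htn (x : R) (hx : t ^ n * x = 0) : x = 0 := (hreg.pow n).right_eq_zero_of_smul hx
  obtain ⟨e, rfl⟩ : t ^ n ∣ i := pow_dvd_of_pow_dvd_pow_mul hreg hdvd m n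
    ⟨i', by linear_combination i' * hij - i * hij' + hmul hi hj' - hmul hi' hj⟩
  obtain rfl : j = t ^ n * (1 - e) := by linear_combination hij
  have he : e * (1 - e) = 0 := htn _ (htn _ (by linear_combination hmul hi hj))
  rcases IsLocalRing.isUnit_or_isUnit_one_sub_self e with hu | hu
  · obtain rfl : e = 1 := (sub_eq_zero.1 (hu.mul_right_eq_zero.1 he)).symm
    rw [mul_one] at hi
    exact .inr ((Submodule.eq_bot_iff J).2 fun x hx ↦ htn x (hmul hi hx))
  · obtain rfl : e = 0 := hu.mul_left_eq_zero.1 he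
    rw [sub_zero, mul_one] at hj
    exact .inl ((Submodule.eq_bot_iff I).2 fun x hx ↦ htn x (by rw [mul_comm, hmul hx hj]))

/- Hartshorne's connectedness theorem. -/
lemma eq_univ_or_eq_univ_of_two_le_depth [IsNoetherianRing R] (h : 2 ≤ depth R)
    {S T : Set (PrimeSpectrum R)} (hS : IsClosed S) (hT : IsClosed T) (hST : S ∪ T = Set.univ)
    (hST' : S ∩ T ⊆ {IsLocalRing.closedPoint R}) : S = Set.univ ∨ T = Set.univ := by
  obtain ⟨I, rfl⟩ := (PrimeSpectrum.isClosed_iff_zeroLocus_ideal S).1 hS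
  obtain ⟨J, rfl⟩ := (PrimeSpectrum.isClosed_iff_zeroLocus_ideal T).1 hT
  rw [← PrimeSpectrum.zeroLocus_mul, PrimeSpectrum.zeroLocus_eq_univ_iff] at hST
  obtain ⟨n, hn⟩ := IsNoetherianRing.isNilpotent_nilradical R
  have hIJ : I ^ n * J ^ n = ⊥ := by
    rw [← mul_pow, ← le_bot_iff, ← Ideal.zero_eq_bot, ← hn]
    exact Ideal.pow_right_mono hST n
  have hrad : IsLocalRing.maximalIdeal R ≤ (I ^ n ⊔ J ^ n).radical := by
    rw [Ideal.radical_eq_sInf]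
    refine le_sInf fun Q ⟨hQ, hQ'⟩ ↦ ?_
    have hmem : (⟨Q, hQ'⟩ : PrimeSpectrum R) ∈
        PrimeSpectrum.zeroLocus (I : Set R) ∩ PrimeSpectrum.zeroLocus J :=
      ⟨hQ'.le_of_pow_le (le_sup_left.trans hQ), hQ'.le_of_pow_le (le_sup_right.trans hQ)⟩
    exact (congrArg PrimeSpectrum.asIdeal (hST' hmem)).ge
  have hzero (I : Ideal R) (hI : I ^ n = ⊥) : PrimeSpectrum.zeroLocus (I : Set R) = Set.univ :=
    Set.eq_univ_of_forall fun x ↦ x.2.le_of_pow_le (hI ▸ bot_le)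
  exact (eq_bot_or_eq_bot_of_two_le_depth h hIJ hrad).imp (hzero I) (hzero J)

end Depth

section FreeIdeal

variable {A : Type*} [CommRing A]

lemma isPrincipal_of_free [Nontrivial A] (I : Ideal A) [Module.Free A I] : I.IsPrincipal :=
  (Submodule.rank_le_one_iff_isPrincipal I).1 ((Submodule.rank_le I).trans (Module.rank_self A).le)

lemma exists_mul_eq_zero_of_lt_isPrincipal {P I : Ideal A} [hP : P.IsPrime] (hfg : P.FG)
    (hI : I.IsPrincipal) (hPI : P < I) : ∃ a, a - 1 ∈ I ∧ ∀ x ∈ P, a * x = 0 := by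
  obtain ⟨f, rfl⟩ := hI
  have hf : f ∉ P := fun h ↦ hPI.not_ge ((Ideal.span_singleton_le_iff_mem P).2 h)
  refine Submodule.exists_sub_one_mem_and_smul_eq_zero_of_fg_of_le_smul _ P hfg fun x hx ↦ ?_
  obtain ⟨y, rfl⟩ := Ideal.mem_span_singleton.1 (hPI.le hx)
  exact Submodule.smul_mem_smul (Ideal.mem_span_singleton_self f)
    ((hP.mem_or_mem hx).resolve_left hf)

end FreeIdeal

section TopologicalDimension

variable {T : Type*} [TopologicalSpace T]

lemma topologicalKrullDim_le_of_forall_exists_open {D : WithBot ℕ∞}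
    (h : ∀ z : T, ∃ U : Opens T, z ∈ U ∧ topologicalKrullDim U ≤ D) :
    topologicalKrullDim T ≤ D := by
  refine Order.krullDim_eq_iSup_coheight.trans_le (iSup_le fun Z ↦ ?_)
  obtain ⟨z, hz⟩ := Z.isIrreducible.nonempty
  obtain ⟨U, hzU, hU⟩ := h z
  rw [Order.coheight_eq_krullDim_Ici]
  refine le_trans ?_ hU
  rw [topologicalKrullDim, Order.krullDim_eq_of_orderIso
    (IrreducibleCloseds.orderIsoOfIsOpenEmbedding _ U.isOpenEmbedding')]
  exact Order.krullDim_le_of_strictMono (fun V : Set.Ici Z ↦ ⟨V.1, ⟨z, hzU⟩, V.2 hz⟩)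
    fun _ _ hVW ↦ hVW

lemma topologicalKrullDim_add_one_le [IrreducibleSpace T] {W : Set T} (hW : IsClosed W)
    (hne : W ≠ Set.univ) : topologicalKrullDim W + 1 ≤ topologicalKrullDim T := by
  cases isEmpty_or_nonempty (IrreducibleCloseds W) with
  | inl _ =>
    rw [topologicalKrullDim, Order.krullDim_eq_bot, WithBot.bot_add]
    exact bot_le
  | inr _ =>
    let top : IrreducibleCloseds T :=
      ⟨Set.univ, IrreducibleSpace.isIrreducible_univ T, isClosed_univ⟩
    let φ : IrreducibleCloseds W → IrreducibleCloseds T :=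
      IrreducibleCloseds.map Subtype.val continuous_subtype_val
    have hφ (Z : IrreducibleCloseds W) : φ Z < top := by
      have hZ : (φ Z : Set T) ⊆ W := closure_minimal (Subtype.coe_image_subset W _) hW
      exact lt_of_le_of_ne (Set.subset_univ _) fun h ↦
        hne (Set.univ_subset_iff.1 (by rwa [h] at hZ))
    rw [topologicalKrullDim, ← Order.krullDim_WithTop]
    have hmono : StrictMono (WithTop.recTopCoe top φ : WithTop (IrreducibleCloseds W) → _) :=
      WithTop.strictMono_iff.2 ⟨IrreducibleCloseds.map_strictMono_of_isInducing .subtypeVal, hφ⟩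
    exact Order.krullDim_le_of_strictMono _ hmono

end TopologicalDimension

section SchemeDimension

variable {Y : Scheme.{u}}

lemma topologicalKrullDim_eq_ringKrullDim {V : Y.Opens} (hV : IsAffineOpen V) :
    topologicalKrullDim V = ringKrullDim Γ(Y, V) := by
  rw [← PrimeSpectrum.topologicalKrullDim_eq_ringKrullDim]
  exact IsHomeomorph.topologicalKrullDim_eq _ hV.isoSpec.hom.homeomorph.isHomeomorph

lemma ringKrullDim_le_of_affineOpens_le {V W : Y.Opens} (hV : IsAffineOpen V) (hW : IsAffineOpen W)
    (h : W ≤ V) : ringKrullDim Γ(Y, W) ≤ ringKrullDim Γ(Y, V) := by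
  rw [← topologicalKrullDim_eq_ringKrullDim hV, ← topologicalKrullDim_eq_ringKrullDim hW]
  exact (Topology.IsEmbedding.inclusion h).isInducing.topologicalKrullDim_le

/-- The algebra structure over `R` on the sections of a scheme over `Spec R`. It depends on the
structure morphism, so it is introduced locally rather than registered as an instance. -/
abbrev sectionsAlgebra {R : Type u} [CommRing R] (f : Y ⟶ Spec (.of R)) (V : Y.Opens) :
    Algebra R Γ(Y, V) :=
  ((Scheme.ΓSpecIso (.of R)).inv ≫ f.appLE ⊤ V (le_top.trans_eq f.preimage_top.symm)).hom.toAlgebra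

lemma finiteType_sections {R : Type u} [CommRing R] (f : Y ⟶ Spec (.of R)) [LocallyOfFiniteType f]
    {V : Y.Opens} (hV : IsAffineOpen V) :
    letI := sectionsAlgebra f V; Algebra.FiniteType R Γ(Y, V) :=
  (f.finiteType_appLE (isAffineOpen_top _) hV le_top).comp (.of_surjective _
    (Scheme.ΓSpecIso (.of R)).symm.commRingCatIsoToRingEquiv.surjective)

lemma ringKrullDim_quotient_primeIdealOf_le {V : Y.Opens} (hV : IsAffineOpen V) (x : V) :
    ringKrullDim (Γ(Y, V) ⧸ (hV.primeIdealOf x).asIdeal) ≤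
      topologicalKrullDim (closure {x.1} : Set Y) := by
  set p := hV.primeIdealOf x with hp
  rw [← PrimeSpectrum.topologicalKrullDim_eq_ringKrullDim]
  let φ : PrimeSpectrum (Γ(Y, V) ⧸ p.asIdeal) → Y :=
    hV.fromSpec ∘ PrimeSpectrum.comap (Ideal.Quotient.mk p.asIdeal)
  have := hV.isOpenImmersion_fromSpec
  have hφ : Topology.IsInducing φ := hV.fromSpec.isOpenEmbedding.isInducing.comp
    (PrimeSpectrum.isClosedEmbedding_comap_of_surjective _ _
      Ideal.Quotient.mk_surjective).isInducing
  have hmem (q) : φ q ∈ closure ({x.1} : Set Y) := by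
    rw [← specializes_iff_mem_closure, ← hV.fromSpec_primeIdealOf x, ← hp]
    have hpq : p ≤ PrimeSpectrum.comap (Ideal.Quotient.mk p.asIdeal) q := fun a ha ↦ by
      simp [Ideal.Quotient.eq_zero_iff_mem.2 ha]
    exact ((PrimeSpectrum.le_iff_specializes _ _).1 hpq).map hV.fromSpec.continuous
  exact (hφ.codRestrict hmem).topologicalKrullDim_le

variable {k : Type u} [Field k] [IsIntegral Y]

lemma ringKrullDim_basicOpen (f : Y ⟶ Spec (.of k)) [LocallyOfFiniteType f]
    {V : Y.Opens} (hV : IsAffineOpen V) [Nonempty V] {h : Γ(Y, V)} (hh : h ≠ 0) :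
    ringKrullDim Γ(Y, Y.basicOpen h) = ringKrullDim Γ(Y, V) := by
  let := sectionsAlgebra f V
  let := sectionsAlgebra f (Y.basicOpen h)
  have := finiteType_sections f hV
  let : Algebra Γ(Y, V) Γ(Y, Y.basicOpen h) :=
    (Y.presheaf.map (homOfLE (Y.basicOpen_le h)).op).hom.toAlgebra
  have : IsLocalization.Away h Γ(Y, Y.basicOpen h) := hV.isLocalization_basicOpen h
  have : IsScalarTower k Γ(Y, V) Γ(Y, Y.basicOpen h) := .of_algebraMap_eq' <|
    congrArg (fun φ ↦ ((Scheme.ΓSpecIso (.of k)).inv ≫ φ).hom)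
      (f.appLE_map (le_top.trans_eq f.preimage_top.symm) (homOfLE (Y.basicOpen_le h)).op).symm
  exact ringKrullDim_eq_of_isLocalization_away k hh

lemma ringKrullDim_sections_le (f : Y ⟶ Spec (.of k)) [LocallyOfFiniteType f]
    {V W : Y.Opens} (hV : IsAffineOpen V) (hW : IsAffineOpen W) [Nonempty V] [Nonempty W] :
    ringKrullDim Γ(Y, V) ≤ ringKrullDim Γ(Y, W) := by
  obtain ⟨x, hxV, hxW⟩ := nonempty_preirreducible_inter V.isOpen W.isOpen
    (Set.nonempty_coe_sort.1 ‹Nonempty V›) (Set.nonempty_coe_sort.1 ‹Nonempty W›)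
  obtain ⟨h, hh, hxh⟩ := hV.exists_basicOpen_le ⟨x, hxW⟩ hxV
  have hh0 : h ≠ 0 := by
    rintro rfl
    simp at hxh
  exact (ringKrullDim_basicOpen f hV hh0).symm.trans_le
    (ringKrullDim_le_of_affineOpens_le hW (hV.basicOpen h) hh)

lemma topologicalKrullDim_le_ringKrullDim_sections (f : Y ⟶ Spec (.of k)) [LocallyOfFiniteType f]
    {V : Y.Opens} (hV : IsAffineOpen V) [Nonempty V] :
    topologicalKrullDim Y ≤ ringKrullDim Γ(Y, V) := by
  refine topologicalKrullDim_le_of_forall_exists_open fun z ↦ ?_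
  obtain ⟨_, ⟨W, hW, rfl⟩, hzW, -⟩ :=
    Y.isBasis_affineOpens.exists_subset_of_mem_open (Set.mem_univ z) isOpen_univ
  have : Nonempty W := ⟨⟨z, hzW⟩⟩
  exact ⟨W, hzW, (topologicalKrullDim_eq_ringKrullDim hW).trans_le
    (ringKrullDim_sections_le f hW hV)⟩

lemma topologicalKrullDim_le_closure_add_one (f : Y ⟶ Spec (.of k)) [LocallyOfFiniteType f] (x : Y)
    (hx : ringKrullDim (Y.presheaf.stalk x) ≤ 1) :
    topologicalKrullDim Y ≤ topologicalKrullDim (closure {x} : Set Y) + 1 := by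
  obtain ⟨_, ⟨V, hV, rfl⟩, hxV, -⟩ :=
    Y.isBasis_affineOpens.exists_subset_of_mem_open (Set.mem_univ x) isOpen_univ
  have : Nonempty V := ⟨⟨x, hxV⟩⟩
  let := sectionsAlgebra f V
  have := finiteType_sections f hV
  have hheight : (hV.primeIdealOf ⟨x, hxV⟩).asIdeal.height ≤ 1 := by
    let := TopCat.Presheaf.algebra_section_stalk Y.presheaf ⟨x, hxV⟩
    have := hV.isLocalization_stalk ⟨x, hxV⟩
    rw [IsLocalization.AtPrime.ringKrullDim_eq_height (hV.primeIdealOf ⟨x, hxV⟩).asIdeal] at hx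
    exact_mod_cast hx
  calc
    topologicalKrullDim Y ≤ ringKrullDim Γ(Y, V) :=
      topologicalKrullDim_le_ringKrullDim_sections f hV
    _ ≤ _ := ringKrullDim_le_ringKrullDim_quotient_add_one k _ hheight
    _ ≤ _ := by gcongr; exact ringKrullDim_quotient_primeIdealOf_le hV ⟨x, hxV⟩

end SchemeDimension

section ProjDomain

variable {σ A : Type u} [CommRing A] [SetLike σ A] [AddSubgroupClass σ A] (𝒜 : ℕ → σ)
  [GradedRing 𝒜]

lemma isReduced_proj [_root_.IsReduced A] : IsReduced (Proj 𝒜) := by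
  have (x : Proj 𝒜) : _root_.IsReduced ((Proj 𝒜).presheaf.stalk x) := by
    have := x.isPrime
    have : _root_.IsReduced (Localization.AtPrime x.asHomogeneousIdeal.toIdeal) := inferInstance
    have : _root_.IsReduced (HomogeneousLocalization.AtPrime 𝒜 x.asHomogeneousIdeal.toIdeal) :=
      isReduced_of_injective
        (algebraMap _ (Localization.AtPrime x.asHomogeneousIdeal.toIdeal))
        (HomogeneousLocalization.val_injective _)
    exact isReduced_of_injective _ (Proj.stalkIso 𝒜 x).commRingCatIsoToRingEquiv.injective
  exact isReduced_of_isReduced_stalk _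

lemma irreducibleSpace_proj [IsDomain A] (h : HomogeneousIdeal.irrelevant 𝒜 ≠ ⊥) :
    IrreducibleSpace (Proj 𝒜) := by
  let η : ProjectiveSpectrum 𝒜 :=
    { asHomogeneousIdeal := ⊥
      isPrime := by
        rw [HomogeneousIdeal.toIdeal_bot]
        exact Ideal.isPrime_bot
      not_irrelevant_le := mt le_bot_iff.1 h }
  have hη : closure ({η} : Set (ProjectiveSpectrum 𝒜)) = Set.univ :=
    Set.eq_univ_of_forall fun x ↦ (ProjectiveSpectrum.le_iff_mem_closure 𝒜 η x).1
      (bot_le : (⊥ : HomogeneousIdeal 𝒜) ≤ _)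
  exact (irreducibleSpace_def (ProjectiveSpectrum 𝒜)).2
    (Eq.subst (motive := IsIrreducible) hη isIrreducible_singleton.closure)

end ProjDomain

section ProjectiveSpace

attribute [local instance] MvPolynomial.gradedAlgebra

variable (k : Type u) [Field k] (N : ℕ)

local notation "𝒜" => MvPolynomial.homogeneousSubmodule (Fin (N + 1)) k

lemma bijective_algebraMap_homogeneousSubmodule_zero :
    Function.Bijective (algebraMap k (𝒜 0)) := by
  refine ⟨fun a b hab ↦ MvPolynomial.C_injective (Fin (N + 1)) k (congrArg Subtype.val hab),
    fun ⟨p, hp⟩ ↦ ⟨MvPolynomial.coeff 0 p, Subtype.ext ?_⟩⟩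
  exact ((MvPolynomial.totalDegree_eq_zero_iff_eq_C).1
    (Nat.le_zero.1 (MvPolynomial.IsHomogeneous.totalDegree_le hp))).symm

instance finiteType_homogeneousSubmodule_zero :
    Algebra.FiniteType (𝒜 0) (MvPolynomial (Fin (N + 1)) k) :=
  have : IsScalarTower k (𝒜 0) (MvPolynomial (Fin (N + 1)) k) :=
    ⟨fun a b c ↦ smul_mul_assoc a b.1 c⟩
  .of_restrictScalars_finiteType k _ _

/-- The structure morphism `ℙ^N ⟶ Spec k` of projective space. -/
def projToSpec : ProjSpace k N ⟶ Spec (.of k) :=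
  Proj.toSpecZero 𝒜 ≫ Spec.map (CommRingCat.ofHom (algebraMap k (𝒜 0)))

instance : IsProper (projToSpec k N) := by
  have : IsIso (CommRingCat.ofHom (algebraMap k (𝒜 0))) :=
    (ConcreteCategory.isIso_iff_bijective _).2 (bijective_algebraMap_homogeneousSubmodule_zero k N)
  unfold projToSpec
  infer_instance

lemma X_mem_irrelevant (j) : (MvPolynomial.X j : MvPolynomial (Fin (N + 1)) k) ∈
    HomogeneousIdeal.irrelevant 𝒜 :=
  DirectSum.decompose_of_mem_ne 𝒜 (MvPolynomial.isHomogeneous_X k j) one_ne_zero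

instance : IsIntegral (ProjSpace k N) :=
  have := isReduced_proj 𝒜
  have : IrreducibleSpace (ProjSpace k N) := irreducibleSpace_proj 𝒜 fun h ↦
    MvPolynomial.X_ne_zero (R := k) (0 : Fin (N + 1)) (h.le (X_mem_irrelevant k N 0))
  isIntegral_of_irreducibleSpace_of_isReduced _

lemma iSup_coordOpen : ⨆ j, coordOpen k N j = ⊤ := by
  refine Proj.iSup_basicOpen_eq_top' 𝒜 _ (fun j ↦ ⟨1, MvPolynomial.isHomogeneous_X k j⟩) ?_
  refine eq_top_iff.2 fun p _ ↦ ?_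
  induction p using MvPolynomial.induction_on with
  | C a =>
    exact (Algebra.adjoin (𝒜 0) (Set.range MvPolynomial.X)).algebraMap_mem (algebraMap k (𝒜 0) a)
  | add p q hp hq => exact add_mem (hp trivial) (hq trivial)
  | mul_X p j hp => exact mul_mem (hp trivial) (Algebra.subset_adjoin ⟨j, rfl⟩)

lemma isAffineOpen_coordOpen (j) : IsAffineOpen (coordOpen k N j) :=
  Proj.isAffineOpen_basicOpen 𝒜 _ (MvPolynomial.isHomogeneous_X k j) zero_lt_one

lemma coordRatio_val (j l) (x : ProjSpace k N) (hx : x ∈ coordOpen k N j) :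
    HomogeneousLocalization.val ((coordRatio k N j l).1 ⟨x, hx⟩) =
      haveI := x.isPrime
      Localization.mk (S := x.asHomogeneousIdeal.toIdeal.primeCompl) (MvPolynomial.X l)
        ⟨MvPolynomial.X j, hx⟩ := by
  have := x.isPrime
  refine (ProjectiveSpectrum.Proj.awayToSection_apply 𝒜 _ _ _).trans ?_
  refine (congrArg _ (HomogeneousLocalization.Away.val_mk 𝒜 1
    (MvPolynomial.isHomogeneous_X k j) _ (MvPolynomial.isHomogeneous_X k l))).trans ?_
  rw [Localization.mk_eq_mk']
  refine (IsLocalization.map_mk' _ _ _).trans ?_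
  rw [Localization.mk_eq_mk']
  exact congrArg (IsLocalization.mk' _ _) (Subtype.ext (pow_one _))

lemma coordRatio_self (j) : coordRatio k N j j = 1 := by
  refine Subtype.ext (funext fun ⟨x, hx⟩ ↦ HomogeneousLocalization.val_injective _ ?_)
  have := ProjectiveSpectrum.isPrime x
  exact ((coordRatio_val k N j j x hx).trans (Localization.mk_self
    (S := x.asHomogeneousIdeal.toIdeal.primeCompl) ⟨MvPolynomial.X j, hx⟩)).trans
    HomogeneousLocalization.val_one.symm

lemma coordRatio_mul (j m l) :
    ((ProjSpace k N).presheaf.map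
        (homOfLE (inf_le_left : coordOpen k N j ⊓ coordOpen k N m ≤ _)).op).hom
        (coordRatio k N j l) =
      ((ProjSpace k N).presheaf.map (homOfLE inf_le_right).op).hom (coordRatio k N m l) *
        ((ProjSpace k N).presheaf.map (homOfLE inf_le_left).op).hom (coordRatio k N j m) := by
  refine Subtype.ext (funext fun ⟨x, hx⟩ ↦ HomogeneousLocalization.val_injective _ ?_)
  have := ProjectiveSpectrum.isPrime x
  refine (coordRatio_val k N j l x hx.1).trans (Eq.trans ?_
    ((HomogeneousLocalization.val_mul _ _).trans (congrArg₂ (· * ·)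
      (coordRatio_val k N m l x hx.2) (coordRatio_val k N j m x hx.1))).symm)
  rw [Localization.mk_mul, Localization.mk_eq_mk_iff, Localization.r_iff_exists]
  exact ⟨1, by simp only [OneMemClass.coe_one, Submonoid.coe_mul]; ring⟩

lemma basicOpen_coordRatio_le (j l) :
    (ProjSpace k N).basicOpen (coordRatio k N j l) ≤ coordOpen k N l := by
  intro x hx hl
  have hxj := (ProjSpace k N).basicOpen_le _ hx
  rw [Scheme.mem_basicOpen _ _ _ hxj] at hx
  have := x.isPrime
  have hunit : IsUnit ((coordRatio k N j l).1 ⟨x, hxj⟩) :=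
    (Proj.stalkIso'_germ 𝒜 _ x hxj _).symm ▸ hx.map (Proj.stalkIso 𝒜 x).hom.hom
  rw [← HomogeneousLocalization.isUnit_iff_isUnit_val, coordRatio_val, Localization.mk_eq_mk',
    IsLocalization.AtPrime.isUnit_mk'_iff _ x.asHomogeneousIdeal.toIdeal] at hunit
  exact hunit hl

end ProjectiveSpace

section Ratio

variable {k : Type u} [Field k] {N : ℕ} {Z : Scheme.{u}} (f : Z ⟶ ProjSpace k N)

lemma iSup_chart : ⨆ j, chart f j = ⊤ := by
  have h := f.preimage_iSup (coordOpen k N)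
  rw [iSup_coordOpen, Scheme.Hom.preimage_top] at h
  exact h.symm

lemma exists_mem_chart (z : Z) : ∃ j, z ∈ chart f j :=
  Opens.mem_iSup.1 (iSup_chart f ▸ Opens.mem_top z)

lemma isAffineOpen_chart [IsAffineHom f] (j) : IsAffineOpen (chart f j) :=
  (isAffineOpen_coordOpen k N j).preimage f

lemma ratioOn_self (j) {W : Z.Opens} (h : W ≤ chart f j) : ratioOn f j j h = 1 := by
  rw [ratioOn, ratio, coordRatio_self, map_one]
  exact map_one _

lemma ratioOn_mul (j m l) {W : Z.Opens} (hj : W ≤ chart f j) (hm : W ≤ chart f m) :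
    ratioOn f j l hj = ratioOn f m l hm * ratioOn f j m hj := by
  have h : W ≤ f ⁻¹ᵁ (coordOpen k N j ⊓ coordOpen k N m) := le_inf hj hm
  have hmul := congrArg (f.appLE _ W h).hom (coordRatio_mul k N j m l)
  rw [map_mul] at hmul
  simp only [← CommRingCat.comp_apply, Scheme.Hom.map_appLE] at hmul
  exact hmul

lemma basicOpen_ratioOn_le (j l) {W : Z.Opens} (hj : W ≤ chart f j) :
    Z.basicOpen (ratioOn f j l hj) ≤ chart f l := by
  rw [ratioOn, Scheme.basicOpen_res]
  exact inf_le_right.trans ((Scheme.preimage_basicOpen f (coordRatio k N j l)).ge.trans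
    fun x hx ↦ basicOpen_coordRatio_le k N j l hx)

end Ratio

section IdealModule

variable {X Z : Scheme.{u}} (f : Z ⟶ X)

/-- The inclusion of the ideal sheaf in the structure sheaf. -/
def idealι : idealModule f ⟶ structureModule X := Limits.kernel.ι (unitToPushforward f)

instance : Mono (idealι f) := inferInstanceAs (Mono (Limits.kernel.ι (unitToPushforward f)))

lemma idealι_comp : idealι f ≫ unitToPushforward f = 0 := Limits.kernel.condition _

/-- The sections over `V` of the ideal sheaf, as functions. -/
def idealSections (V : X.Opens) : Γ(idealModule f, V) →ₗ[Γ(X, V)] Γ(X, V) where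
  toFun x := (idealι f).app V x
  map_add' x y := ((idealι f).app V).hom.map_add x y
  map_smul' r x := (idealι f).app_smul r x

/-- The functor of sections over `V`, in abelian groups. -/
def sectionsFunctor (V : X.Opens) : X.Modules ⥤ Ab.{u} :=
  Scheme.Modules.toPresheaf X ⋙ (evaluation _ _).obj (op V)

instance (V : X.Opens) : (sectionsFunctor V).PreservesZeroMorphisms := ⟨fun _ _ ↦ rfl⟩

instance (V : X.Opens) : Limits.PreservesFiniteLimits (sectionsFunctor V) where
  preservesFiniteLimits J _ _ := by
    have := Limits.PreservesLimitsOfSize.preservesFiniteLimits (Scheme.Modules.toPresheaf X)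
    have : Limits.HasLimitsOfShape J Ab.{u} := Limits.HasFiniteLimits.out J
    have : Limits.PreservesLimitsOfShape J ((evaluation (Opens X)ᵒᵖ Ab.{u}).obj (op V)) :=
      Limits.evaluation_preservesLimitsOfShape (op V)
    exact Limits.comp_preservesLimitsOfShape _ _

lemma exact_map_idealι {C : Type*} [Category* C] [Abelian C] (F : X.Modules ⥤ C)
    [F.PreservesZeroMorphisms] [Limits.PreservesFiniteLimits F] :
    ((ShortComplex.mk (idealι f) (unitToPushforward f) (idealι_comp f)).map F).Exact :=
  ShortComplex.Exact.map_of_mono_of_preservesKernel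
    (ShortComplex.exact_of_f_is_kernel _ (Limits.kernelIsKernel (unitToPushforward f))) _
    (inferInstanceAs (Mono (idealι f))) inferInstance

lemma idealSections_injective (V : X.Opens) : Function.Injective (idealSections f V) := by
  have := (inferInstance : Mono ((sectionsFunctor V).map (idealι f)))
  exact (AddCommGrpCat.mono_iff_injective _).1 this

lemma range_idealSections (V : X.Opens) :
    LinearMap.range (idealSections f V) = RingHom.ker (f.app V).hom := by
  refine le_antisymm ?_ fun a ha ↦
    (ShortComplex.ab_exact_iff _).1 (exact_map_idealι f (sectionsFunctor V)) a ha
  rintro _ ⟨x, rfl⟩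
  exact ConcreteCategory.congr_hom (congrArg (Scheme.Modules.Hom.app · V) (idealι_comp f)) x

/-- Sections of the ideal sheaf are the functions that vanish on the closed subscheme. -/
def idealSectionsEquiv (V : X.Opens) :
    Γ(idealModule f, V) ≃ₗ[Γ(X, V)] RingHom.ker (f.app V).hom :=
  (LinearEquiv.ofInjective _ (idealSections_injective f V)).trans
    (LinearEquiv.ofEq _ _ (range_idealSections f V))

lemma idealSections_res {U V : X.Opens} (h : V ≤ U) (x : Γ(idealModule f, U)) :
    idealSections f V (res _ h x) = (X.presheaf.map (homOfLE h).op).hom (idealSections f U x) :=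
  ConcreteCategory.congr_hom ((idealι f).mapPresheaf.naturality (homOfLE h).op) x

end IdealModule

section Free

variable {X : Scheme.{u}}

/-- An isomorphism of modules on sections over `V`. -/
def sectionsEquiv {M M' : X.Modules} (e : M ≅ M') (V : X.Opens) :
    Γ(M, V) ≃ₗ[Γ(X, V)] Γ(M', V) where
  toFun := e.hom.app V
  invFun := e.inv.app V
  map_add' := ((e.hom.app V).hom.map_add)
  map_smul' := e.hom.app_smul
  left_inv := ConcreteCategory.congr_hom (congrArg (Scheme.Modules.Hom.app · V) e.hom_inv_id)
  right_inv := ConcreteCategory.congr_hom (congrArg (Scheme.Modules.Hom.app · V) e.inv_hom_id)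

lemma free_sections_of_restrict {U : Scheme.{u}} (f : U ⟶ X) [IsOpenImmersion f] (M : X.Modules)
    (V : U.Opens) [Module.Free Γ(U, V) Γ(M.restrict f, V)] :
    Module.Free Γ(X, f ''ᵁ V) Γ(M, f ''ᵁ V) := by
  let σ : Γ(U, V) ≃+* Γ(X, f ''ᵁ V) := (f.appIso V).symm.commRingCatIsoToRingEquiv
  have := RingHomInvPair.of_ringEquiv σ
  have := RingHomInvPair.of_ringEquiv_symm σ
  let e : Γ(M.restrict f, V) ≃ₛₗ[(σ : Γ(U, V) →+* Γ(X, f ''ᵁ V))] Γ(M, f ''ᵁ V) :=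
    { AddEquiv.refl Γ(M, f ''ᵁ V) with
      map_smul' := Scheme.Modules.smul_restrictAppIso_hom_apply f M V }
  exact Module.Free.of_equiv e

/-- The free module of rank `r`. -/
abbrev freeModule (X : Scheme.{u}) (r : ℕ) : X.Modules :=
  (SheafOfModules.free (R := X.ringCatSheaf) (ULift.{u} (Fin r)) : SheafOfModules X.ringCatSheaf)

instance free_sections_freeModule (V : X.Opens) (r : ℕ) :
    Module.Free Γ(X, V) Γ(freeModule X r, V) := by
  have := Abelian.hasFiniteBiproducts (C := SheafOfModules.{u} X.ringCatSheaf)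
  let G := SheafOfModules.evaluation.{u} X.ringCatSheaf (op V)
  let F : ULift.{u} (Fin r) → SheafOfModules.{u} X.ringCatSheaf := fun _ ↦ SheafOfModules.unit _
  let R := X.ringCatSheaf.obj.obj (op V)
  let e : G.obj (∐ F) ≅ ModuleCat.of R (∀ i, G.obj (F i)) :=
    G.mapIso ((Limits.biproduct.isoCoproduct F).symm ≪≫ Limits.biproduct.isoProduct F) ≪≫
      Limits.PreservesProduct.iso G F ≪≫ ModuleCat.piIsoPi _
  let e' : (ULift.{u} (Fin r) → R) ≃ₗ[R] G.obj (∐ F) := e.symm.toLinearEquiv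
  have : Module.Free R (G.obj (∐ F)) := .of_equiv e'
  exact this

lemma exists_free_sections_of_isLocallyFreeAt {M : X.Modules} {p : X} (h : IsLocallyFreeAt M p) :
    ∃ U : X.Opens, p ∈ U ∧ ∀ V ≤ U, Module.Free Γ(X, V) Γ(M, V) := by
  obtain ⟨U, hp, r, ⟨e⟩⟩ := h
  refine ⟨U, hp, fun V hV ↦ ?_⟩
  obtain ⟨V, rfl⟩ : ∃ V' : U.toScheme.Opens, U.ι ''ᵁ V' = V :=
    ⟨U.ι ⁻¹ᵁ V, by simp [Scheme.Hom.image_preimage_eq_opensRange_inf, hV]⟩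
  have : Module.Free Γ(U, V) Γ(M.restrict U.ι, V) :=
    .of_equiv' (free_sections_freeModule V r) (sectionsEquiv e.symm V)
  exact free_sections_of_restrict U.ι M V

lemma IsLocallyFreeAt.of_iso {M M' : X.Modules} (e : M ≅ M') {p : X} (h : IsLocallyFreeAt M p) :
    IsLocallyFreeAt M' p := by
  obtain ⟨U, hp, r, ⟨e'⟩⟩ := h
  exact ⟨U, hp, r, ⟨(Scheme.Modules.restrictFunctor U.ι).mapIso e.symm ≪≫ e'⟩⟩

lemma isIso_of_bijective_app_affineOpens {M M' : X.Modules} (φ : M ⟶ M')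
    (h : ∀ V : X.affineOpens, Function.Bijective (φ.app V.1)) : IsIso φ := by
  let ψ : (⟨_, M.isSheaf⟩ : TopCat.Sheaf Ab.{u} X) ⟶ ⟨_, M'.isSheaf⟩ := ⟨φ.mapPresheaf⟩
  have : IsIso ψ := TopCat.Sheaf.isIso_iff_isIso_basis
    (B := fun V : X.affineOpens ↦ V.1) (by simpa using X.isBasis_affineOpens)
    fun V ↦ (ConcreteCategory.isIso_iff_bijective _).2 (h V)
  have : IsIso ((Scheme.Modules.toPresheaf _).map φ) :=
    inferInstanceAs (IsIso ((sheafToPresheaf _ _).map ψ))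
  exact isIso_of_reflects_iso φ (Scheme.Modules.toPresheaf _)

lemma isLocallyFreeAt_of_bijective_smul {M : X.Modules} {U : X.Opens} (m : Γ(M, U))
    (h : ∀ V : X.affineOpens, ∀ hV : V.1 ≤ U,
      Function.Bijective fun a : Γ(X, V.1) ↦ a • res M hV m) {p : X} (hp : p ∈ U) :
    IsLocallyFreeAt M p := by
  let M' : SheafOfModules U.toScheme.ringCatSheaf := M.restrict U.ι
  let s : M'.sections := PresheafOfModules.sectionsMk
    (fun V ↦ res M (U.ι_image_le V.unop) m) (fun V W g ↦ res_res M (U.ι_image_le V.unop)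
      (U.ι.image_mono (leOfHom g.unop)) m)
  let φ : structureModule U.toScheme ⟶ M.restrict U.ι := M'.unitHomEquiv.symm s
  have hφ (V : U.toScheme.Opens) (a : Γ(X, U.ι ''ᵁ V)) :
      φ.app V a = a • res M (U.ι_image_le V) m := by
    have := Scheme.Modules.smul_restrictAppIso_hom_apply U.ι M V a (res M (U.ι_image_le V) m)
    rw [Scheme.Opens.ι_appIso] at this
    exact this
  have : IsIso φ := isIso_of_bijective_app_affineOpens φ fun V ↦
    (congrArg Function.Bijective (funext (hφ V.1))).mpr
      (h ⟨U.ι ''ᵁ V.1, V.2.image_of_isOpenImmersion U.ι⟩ (U.ι_image_le V.1))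
  exact ⟨U, hp, 1, ⟨(asIso φ).symm ≪≫ (Limits.coproductUniqueIso
    fun _ : ULift.{u} (Fin 1) ↦ SheafOfModules.unit U.toScheme.ringCatSheaf).symm⟩⟩

lemma isLocallyFreeAt_idealModule {Z : Scheme.{u}} (f : Z ⟶ X) {U : X.Opens} (g : Γ(X, U))
    (hg : (f.app U).hom g = 0)
    (h : ∀ V : X.affineOpens, ∀ hV : V.1 ≤ U,
      (X.presheaf.map (homOfLE hV).op).hom g ∈ nonZeroDivisors Γ(X, V.1) ∧
      RingHom.ker (f.app V.1).hom ≤ Ideal.span {(X.presheaf.map (homOfLE hV).op).hom g})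
    {p : X} (hp : p ∈ U) : IsLocallyFreeAt (idealModule f) p := by
  obtain ⟨m, hm⟩ : g ∈ LinearMap.range (idealSections f U) :=
    (range_idealSections f U).symm ▸ hg
  have hm' (V : X.affineOpens) (hV : V.1 ≤ U) (a) : idealSections f V.1 (a • res _ hV m) =
      a * (X.presheaf.map (homOfLE hV).op).hom g := by
    rw [map_smul, idealSections_res, hm, smul_eq_mul]
  refine isLocallyFreeAt_of_bijective_smul m (fun V hV ↦ ⟨fun a b hab ↦ ?_, fun x ↦ ?_⟩) hp
  · exact (mul_cancel_right_mem_nonZeroDivisors (h V hV).1).1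
      ((hm' V hV a).symm.trans ((congrArg _ hab).trans (hm' V hV b)))
  · have hx : idealSections f V.1 x ∈ RingHom.ker (f.app V.1).hom :=
      range_idealSections f V.1 ▸ LinearMap.mem_range_self _ x
    obtain ⟨a, ha⟩ := Ideal.mem_span_singleton'.1 ((h V hV).2 hx)
    exact ⟨a, idealSections_injective f V.1 ((hm' V hV a).trans ha)⟩

end Free

section Cohomology

variable {X Z : Scheme.{u}}

/-- The underlying sheaf of abelian groups of a module. -/
def abSheaf (X : Scheme.{u}) :
    X.Modules ⥤ Sheaf (Opens.grothendieckTopology X) Ab.{u} :=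
  SheafOfModules.toSheaf X.ringCatSheaf

instance : (abSheaf X).PreservesZeroMorphisms := ⟨fun _ _ ↦ rfl⟩

instance : Limits.PreservesFiniteLimits (abSheaf X) :=
  inferInstanceAs (Limits.PreservesFiniteLimits (SheafOfModules.toSheaf X.ringCatSheaf))

instance epi_unitToPushforward (f : Z ⟶ X) [IsClosedImmersion f] :
    Epi ((abSheaf X).map (unitToPushforward f)) := by
  refine (TopCat.Sheaf.isLocallySurjective_iff_epi (X := X.carrier) _).1 ?_
  rw [TopCat.Presheaf.isLocallySurjective_iff]
  intro U t x hx
  obtain ⟨_, ⟨V, hV, rfl⟩, hxV, hVU⟩ := X.isBasis_affineOpens.exists_subset_of_mem_open hx U.2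
  exact ⟨V, hVU, f.app_surjective V hV _, hxV⟩

lemma shortExact_idealι (f : Z ⟶ X) [IsClosedImmersion f] :
    ((ShortComplex.mk (idealι f) (unitToPushforward f) (idealι_comp f)).map
      (abSheaf X)).ShortExact where
  exact := exact_map_idealι f (abSheaf X)
  mono_f := inferInstanceAs (Mono ((abSheaf X).map (idealι f)))
  epi_g := epi_unitToPushforward f

lemma surjective_app_top_of_subsingleton_H (f : Z ⟶ X) [IsClosedImmersion f]
    (h : Subsingleton (((abSheaf X).obj (idealModule f)).H 1)) :
    Function.Surjective (f.app ⊤).hom := by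
  intro y
  let S := (ShortComplex.mk (idealι f) (unitToPushforward f) (idealι_comp f)).map (abSheaf X)
  have hT : Limits.IsTerminal (⊤ : Opens X) := Limits.isTerminalTop
  let y' : S.X₃.obj.obj (op ⊤) := y
  have : Subsingleton (S.X₁.H 1) := h
  obtain ⟨x, hx⟩ := Abelian.Ext.covariant_sequence_exact₃ _ (shortExact_idealι f : S.ShortExact)
    ((Sheaf.H.equiv₀ S.X₃ hT).symm y') rfl (Subsingleton.elim _ _)
  have hy := Sheaf.H.equiv₀_naturality hT S.g x
  rw [Sheaf.H.map_apply, hx, AddEquiv.apply_symm_apply] at hy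
  exact ⟨_, hy⟩

lemma eq_bot_of_subsingleton {U : X.Opens} (h : Subsingleton Γ(X, U)) : U = ⊥ := by
  refine eq_bot_iff.2 fun x hx ↦ ?_
  have := congrArg (X.presheaf.germ U x hx).hom (Subsingleton.elim (0 : Γ(X, U)) 1)
  rw [map_zero, map_one] at this
  exact (zero_ne_one this).elim

lemma preconnectedSpace_of_forall_isIdempotentElem
    (h : ∀ e : Γ(X, ⊤), IsIdempotentElem e → e = 0 ∨ e = 1) : PreconnectedSpace X := by
  rw [preconnectedSpace_iff_clopen]
  intro s hs
  let U : X.Opens := ⟨s, hs.isOpen⟩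
  let V : X.Opens := ⟨sᶜ, hs.compl.isOpen⟩
  have hsup : U ⊔ V = ⊤ := Opens.ext (Set.union_compl_self s)
  have hinf : U ⊓ V = ⊥ := Opens.ext (Set.inter_compl_self s)
  have : Subsingleton Γ(X, U ⊓ V) := by rw [hinf]; infer_instance
  rw [← hsup] at h
  let e := (X.sheaf.objSupIsoProdEqLocus U V).inv.hom
    ⟨(1, 0), Subsingleton.elim (α := Γ(X, U ⊓ V)) _ _⟩
  have he : IsIdempotentElem e := IsIdempotentElem.map
    (Subtype.ext (Prod.ext (one_mul 1) (zero_mul 0)) : IsIdempotentElem _) _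
  have heU : (X.presheaf.map (homOfLE le_sup_left).op).hom e = (1 : Γ(X, U)) :=
    X.sheaf.objSupIsoProdEqLocus_inv_fst U V _
  have heV : (X.presheaf.map (homOfLE le_sup_right).op).hom e = (0 : Γ(X, V)) :=
    X.sheaf.objSupIsoProdEqLocus_inv_snd U V _
  rcases h e he with he | he
  · rw [he, map_zero] at heU
    exact .inl (congrArg SetLike.coe (eq_bot_of_subsingleton (subsingleton_of_zero_eq_one heU)))
  · rw [he, map_one] at heV
    exact .inr (Set.compl_empty_iff.1
      (congrArg SetLike.coe (eq_bot_of_subsingleton (subsingleton_of_zero_eq_one heV.symm))))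

lemma preconnectedSpace_of_surjective_of_isField {K : Type*} [CommRing K] (hK : IsField K)
    (φ : K →+* Γ(X, ⊤)) (hφ : Function.Surjective φ) : PreconnectedSpace X := by
  refine preconnectedSpace_of_forall_isIdempotentElem fun e he ↦ ?_
  obtain ⟨a, rfl⟩ := hφ e
  let := hK.toField
  rcases eq_or_ne a 0 with rfl | ha
  · exact .inl (map_zero φ)
  · exact .inr (((isUnit_iff_ne_zero.2 ha).map φ).mul_left_cancel (he.trans (mul_one _).symm))

variable {k : Type u} [Field k] {N : ℕ}

/-- The canonical morphism from `M` to its twist `M(0)`. -/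
def toTwistZero (f : Z ⟶ ProjSpace k N) (M : Z.Modules) : (abSheaf Z).obj M ⟶ twist f M 0 where
  hom :=
    { app U := AddCommGrpCat.ofHom
        { toFun x := ⟨fun j ↦ res M inf_le_left x, fun j l ↦ by
            simp only [Int.toNat_zero, neg_zero, pow_zero, one_smul]
            exact (res_res M _ _ x).trans (res_res M _ _ x).symm⟩
          map_zero' := Subtype.ext (funext fun j ↦ map_zero (res M inf_le_left))
          map_add' x y := Subtype.ext (funext fun j ↦ map_add (res M inf_le_left) x y) }
      naturality U V g := by
        ext x
        refine Subtype.ext (funext fun j ↦ ?_)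
        exact (res_res M (leOfHom g.unop) inf_le_left x).trans
          (res_res M inf_le_left (inf_le_inf_right _ (leOfHom g.unop)) x).symm }

lemma bijective_toTwistZero_app (f : Z ⟶ ProjSpace k N) (M : Z.Modules) (U : Z.Opens) :
    Function.Bijective ((toTwistZero f M).hom.app (op U)) := by
  let W (j : ULift.{u} (Fin (N + 1))) : Z.Opens := U ⊓ chart f j.down
  have hcov : U ≤ iSup W := fun z hz ↦
    have ⟨j, hj⟩ := exists_mem_chart f z
    Opens.mem_iSup.2 ⟨⟨j⟩, hz, hj⟩
  refine ⟨fun x y hxy ↦ res_ext M W (fun j ↦ inf_le_left) hcov fun j ↦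
    congrFun (congrArg Subtype.val hxy) j.down, fun ⟨s, hs⟩ ↦ ?_⟩
  have hcomp : TopCat.Presheaf.IsCompatible M.presheaf W fun j ↦ s j.down := fun j l ↦ by
    have hjl := hs j.down l.down
    simp only [Int.toNat_zero, neg_zero, pow_zero, one_smul] at hjl
    have hle : W j ⊓ W l ≤ U ⊓ (chart f j.down ⊓ chart f l.down) :=
      le_inf (inf_le_left.trans inf_le_left) (inf_le_inf inf_le_right inf_le_right)
    have := congrArg (res M hle) hjl
    rw [res_res, res_res] at this
    exact this.symm
  obtain ⟨x, hx, -⟩ := TopCat.Sheaf.existsUnique_gluing' ⟨M.presheaf, M.isSheaf⟩ W U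
    (fun j ↦ homOfLE inf_le_left) hcov (fun j ↦ s j.down) hcomp
  exact ⟨x, Subtype.ext (funext fun j ↦ hx ⟨j⟩)⟩

instance (f : Z ⟶ ProjSpace k N) (M : Z.Modules) : IsIso (toTwistZero f M) := by
  have : IsIso ((sheafToPresheaf _ _).map (toTwistZero f M)) :=
    (NatTrans.isIso_iff_isIso_app _).2 fun U ↦
      (ConcreteCategory.isIso_iff_bijective _).2 (bijective_toTwistZero_app f M U.unop)
  exact isIso_of_reflects_iso _ (sheafToPresheaf _ _)

lemma preconnectedSpace_of_hasACMVanishing (i : X ⟶ ProjSpace k N)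
    [IsClosedImmersion i] {n : ℕ} (hn : 2 ≤ n) (h : HasACMVanishing i n) :
    PreconnectedSpace X := by
  have hH : Subsingleton (((abSheaf _).obj (idealModule i)).H 1) := by
    have : Subsingleton ((twist (𝟙 _) (idealModule i) 0).H 1) := h 0 1 le_rfl (by omega)
    let e : ((abSheaf _).obj (idealModule i)).H 1 ≃+ (twist (𝟙 _) (idealModule i) 0).H 1 :=
      ((Sheaf.functorH _ 1).mapIso
        (asIso (toTwistZero (𝟙 _) (idealModule i)))).addCommGroupIsoToAddEquiv
    exact e.toEquiv.subsingleton
  exact preconnectedSpace_of_surjective_of_isField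
    (isField_of_universallyClosed k (projToSpec k N)) (i.app ⊤).hom
    (surjective_app_top_of_subsingleton_H i hH)

end Cohomology

section Reduced

variable {X : Scheme.{u}}

lemma isReduced_subscheme {I : X.IdealSheafData} (h : ∀ V, (I.ideal V).IsRadical) :
    IsReduced I.subscheme := by
  have (V : X.affineOpens) : IsReduced (I.subschemeCover.openCover.X V) := by
    have : _root_.IsReduced (Γ(X, V.1) ⧸ I.ideal V) :=
      (Ideal.isRadical_iff_quotient_reduced _).1 (h V)
    exact inferInstanceAs (IsReduced (Spec (.of (Γ(X, V.1) ⧸ I.ideal V))))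
  exact @IsReduced.of_openCover _ I.subschemeCover.openCover this

lemma radical_eq_of_isReduced_subscheme (I : X.IdealSheafData) [IsReduced I.subscheme] :
    I.radical = I := by
  ext V : 2
  refine Ideal.IsRadical.radical (I := I.ideal V) ?_
  rw [← I.ker_subschemeι_app V]
  exact (RingHom.ker_isRadical_iff_reduced_of_surjective (I.subschemeι_app_surjective V)).2
    inferInstance

lemma eq_of_support_eq {I J : X.IdealSheafData} [IsReduced I.subscheme] [IsReduced J.subscheme]
    (h : I.support = J.support) : I = J := by
  rw [← radical_eq_of_isReduced_subscheme I, ← radical_eq_of_isReduced_subscheme J,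
    ← Scheme.IdealSheafData.vanishingIdeal_support, h,
    Scheme.IdealSheafData.vanishingIdeal_support]

instance (Y : Closeds X) : IsReduced (reducedScheme Y) :=
  isReduced_subscheme fun _ ↦ PrimeSpectrum.isRadical_vanishingIdeal _

lemma range_reducedι (Y : Closeds X) : Set.range (reducedι Y) = Y := by
  rw [Scheme.IdealSheafData.range_subschemeι, Scheme.IdealSheafData.coe_support_vanishingIdeal]

lemma reducedι_mem (Y : Closeds X) (t : reducedScheme Y) : reducedι Y t ∈ Y :=
  (range_reducedι Y).subset (Set.mem_range_self t)

lemma exists_reducedι_eq {Y : Closeds X} {p : X} (hp : p ∈ Y) : ∃ t, reducedι Y t = p :=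
  (range_reducedι Y).superset hp

lemma isIntegral_reducedScheme {Y : Closeds X} (hY : IsIrreducible (Y : Set X)) :
    IsIntegral (reducedScheme Y) := by
  have : IrreducibleSpace (reducedScheme Y) := by
    refine Subtype.irreducibleSpace ?_
    rw [Scheme.IdealSheafData.coe_support_vanishingIdeal]
    exact hY
  exact isIntegral_of_irreducibleSpace_of_isReduced _

lemma isPrime_vanishingIdeal {Y : Closeds X} (hY : IsIrreducible (Y : Set X)) (V : X.affineOpens)
    {p : X} (hp : p ∈ Y) (hpV : p ∈ V.1) :
    ((Scheme.IdealSheafData.vanishingIdeal Y).ideal V).IsPrime := by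
  have := isIntegral_reducedScheme hY
  obtain ⟨t, rfl⟩ := exists_reducedι_eq hp
  have : Nonempty (reducedι Y ⁻¹ᵁ V.1 : (reducedScheme Y).Opens) := ⟨⟨t, hpV⟩⟩
  rw [← Scheme.IdealSheafData.ker_subschemeι_app]
  exact RingHom.ker_isPrime _

lemma ideal_eq_bot_of_le {I : X.IdealSheafData} {V W : X.affineOpens} (h : I.ideal V = ⊥)
    (hW : W ≤ V) : I.ideal W = ⊥ := by
  rw [← I.map_ideal hW, h, Ideal.map_bot]

lemma isIso_stalkMap_of_ideal_eq_bot {I : X.IdealSheafData} {V : X.affineOpens}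
    (h : I.ideal V = ⊥) (t : I.subscheme) (ht : I.subschemeι t ∈ V.1) :
    IsIso (I.subschemeι.stalkMap t) := by
  have : IsAffine V.1 := V.2
  have : IsIso (I.subschemeι ∣_ V.1) := by
    refine IsClosedImmersion.isIso_iff_ker_eq_bot.2 (Scheme.IdealSheafData.ext_of_isAffine ?_)
    rw [Scheme.ker_morphismRestrict_ideal, Scheme.IdealSheafData.ker_subschemeι]
    exact ideal_eq_bot_of_le h V.1.ι_image_top.le
  have hmap (x) : IsIso ((I.subschemeι ∣_ V.1).stalkMap x) := inferInstance
  exact ((MorphismProperty.isomorphisms _).arrow_mk_iso_iff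
    (morphismRestrictStalkMap I.subschemeι V.1 ⟨t, ht⟩)).1 (hmap _)

lemma hasMultiplicityOne_of_ideal_eq_bot {Y : Closeds X} {V : X.affineOpens}
    (h : (Scheme.IdealSheafData.vanishingIdeal Y).ideal V = ⊥) {p : X} (hp : p ∈ Y)
    (hpV : p ∈ V.1) : HasMultiplicityOne Y := by
  obtain ⟨t, rfl⟩ := exists_reducedι_eq hp
  exact ⟨reducedι Y ⁻¹ᵁ V.1, ⟨t, hpV⟩, fun x hx ↦
    (ConcreteCategory.isIso_iff_bijective _).1 (isIso_stalkMap_of_ideal_eq_bot h x hx)⟩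

lemma exists_ideal_eq_bot_of_lt_isPrincipal [IsLocallyNoetherian X] {J : X.IdealSheafData}
    {V : X.affineOpens} (hJ : (J.ideal V).IsPrime) {I : Ideal Γ(X, V.1)} (hI : I.IsPrincipal)
    (hJI : J.ideal V < I) : ∃ a, a - 1 ∈ I ∧ J.ideal (X.affineBasicOpen a) = ⊥ := by
  have : IsNoetherianRing Γ(X, V.1) := IsLocallyNoetherian.component_noetherian V
  obtain ⟨a, ha, haJ⟩ := exists_mul_eq_zero_of_lt_isPrincipal (IsNoetherian.noetherian _) hI hJI
  refine ⟨a, ha, (J.map_ideal_basicOpen V a).symm.trans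
    (eq_bot_iff.2 (Ideal.map_le_iff_le_comap.2 fun x hx ↦ Ideal.mem_bot.2 ?_))⟩
  have hu : IsUnit ((X.presheaf.map (homOfLE (X.basicOpen_le a)).op).hom a) :=
    RingedSpace.isUnit_res_basicOpen _ a
  exact hu.mul_right_eq_zero.1 (by rw [← map_mul, haJ x hx, map_zero])

lemma isLocallyFreeAt_of_ker_app_eq_span {Z : Scheme.{u}} (f : Z ⟶ X) [IsClosedImmersion f]
    {V : X.affineOpens} {g : Γ(X, V.1)} (hg : g ∈ nonZeroDivisors Γ(X, V.1))
    (h : RingHom.ker (f.app V.1).hom = Ideal.span {g}) {p : X} (hp : p ∈ V.1) :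
    IsLocallyFreeAt (idealModule f) p := by
  refine isLocallyFreeAt_idealModule f g ?_ (fun W hW ↦ ⟨?_, ?_⟩) hp
  · rw [← RingHom.mem_ker, h]
    exact Ideal.mem_span_singleton_self g
  · let := (X.presheaf.map (homOfLE hW).op).hom.toAlgebra
    have : Module.Flat Γ(X, V.1) Γ(X, W.1) := (𝟙 X : X ⟶ X).flat_appLE V.2 W.2 hW
    exact mem_nonZeroDivisors_iff_right.2 fun x hx ↦
      (Module.Flat.isSMulRegular_of_nonZeroDivisors hg).right_eq_zero_of_smul
        ((mul_comm _ _).trans hx)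
  · rw [← f.ker_apply, ← f.ker.map_ideal hW, f.ker_apply, h, Ideal.map_span, Set.image_singleton]
    rfl

lemma isLocallyFreeAt_of_notMem_range {Z : Scheme.{u}} (f : Z ⟶ X) [IsClosedImmersion f] {p : X}
    (hp : p ∉ Set.range f) : IsLocallyFreeAt (idealModule f) p := by
  obtain ⟨V, hV, hpV, hVf⟩ := exists_isAffineOpen_mem_and_subset
    (U := ⟨(Set.range f)ᶜ, f.isClosedEmbedding.isClosed_range.isOpen_compl⟩) hp
  have hbot : f ⁻¹ᵁ V = ⊥ := eq_bot_iff.2 fun z hz ↦ (hVf hz ⟨z, rfl⟩).elim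
  have : Subsingleton Γ(Z, f ⁻¹ᵁ V) := by
    rw [hbot]
    infer_instance
  refine isLocallyFreeAt_of_ker_app_eq_span f (V := ⟨V, hV⟩) (one_mem _) ?_ hpV
  rw [Ideal.span_singleton_one]
  exact eq_top_iff.2 fun _ _ ↦ Subsingleton.elim _ _

end Reduced

section Divisor

variable {X : Scheme.{u}} {Y : Closeds X}

lemma range_divisorι (C : (reducedScheme Y).IdealSheafData) :
    Set.range (divisorι Y C) = reducedι Y '' C.support := by
  rw [Scheme.Hom.comp_base, TopCat.coe_comp, Set.range_comp, C.range_subschemeι]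

lemma range_divisorι_subset (C : (reducedScheme Y).IdealSheafData) :
    Set.range (divisorι Y C) ⊆ Y := by
  rw [range_divisorι]
  rintro _ ⟨t, -, rfl⟩
  exact reducedι_mem Y t

lemma eq_of_range_divisorι_eq {C₁ C₂ : (reducedScheme Y).IdealSheafData}
    [IsReduced C₁.subscheme] [IsReduced C₂.subscheme]
    (h : Set.range (divisorι Y C₁) = Set.range (divisorι Y C₂)) : C₁ = C₂ := by
  rw [range_divisorι, range_divisorι] at h
  exact eq_of_support_eq (SetLike.coe_injective
    ((reducedι Y).isEmbedding.injective.image_injective h))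

lemma ker_divisorι_app (C : (reducedScheme Y).IdealSheafData) (V : X.affineOpens) :
    RingHom.ker ((divisorι Y C).app V.1).hom =
      (C.ideal ⟨_, V.2.preimage (reducedι Y)⟩).comap ((reducedι Y).app V.1).hom := by
  rw [← Scheme.IdealSheafData.ideal_map_of_isAffineHom, Scheme.IdealSheafData.map,
    ← Scheme.Hom.ker_apply]

lemma nonLocallyFreeLocus_subset_range (C : (reducedScheme Y).IdealSheafData) :
    nonLocallyFreeLocus Y C ⊆ Set.range (divisorι Y C) :=
  fun _ hp ↦ by_contra fun h ↦ hp.2 (isLocallyFreeAt_of_notMem_range _ h)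

lemma nonLocallyFreeLocus_eq_of_iso {C₁ C₂ : (reducedScheme Y).IdealSheafData}
    (e : idealModule (divisorι Y C₁) ≅ idealModule (divisorι Y C₂)) :
    nonLocallyFreeLocus Y C₁ = nonLocallyFreeLocus Y C₂ :=
  Set.ext fun _ ↦ and_congr_right fun _ ↦ not_congr ⟨fun h ↦ h.of_iso e, fun h ↦ h.of_iso e.symm⟩

variable {k : Type u} [Field k] {N : ℕ}

lemma section_eq_zero_of_res_eq_zero {T : Scheme.{u}} [IsIntegral T] (f : T ⟶ ProjSpace k N)
    {e : ℤ} (he : 0 ≤ e) {s : twistSections f (structureModule T) e ⊤} (l : Fin (N + 1))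
    {V : T.Opens} [hV : Nonempty V] (h : V ≤ ⊤ ⊓ chart f l)
    (h0 : (T.presheaf.map (homOfLE h).op).hom (s.1 l : Γ(T, ⊤ ⊓ chart f l)) = 0) : s = 0 := by
  have hl : s.1 l = 0 := map_injective_of_isIntegral T (homOfLE h) (h0.trans (map_zero _).symm)
  refine Subtype.ext (funext fun j ↦ ?_)
  rcases isEmpty_or_nonempty (⊤ ⊓ chart f j : T.Opens) with hj | ⟨x, hx⟩
  · have : ⊤ ⊓ chart f j = ⊥ := eq_bot_iff.2 fun x hx ↦ hj.elim ⟨x, hx⟩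
    have : Subsingleton Γ(T, ⊤ ⊓ chart f j) := by rw [this]; infer_instance
    exact Subsingleton.elim (α := Γ(T, ⊤ ⊓ chart f j)) _ _
  · obtain ⟨y, hy⟩ := hV
    obtain ⟨z, -, hzj, hzl⟩ := (PreirreducibleSpace.isPreirreducible_univ (X := T)) _ _
      (chart f j).2 (chart f l).2 ⟨x, trivial, hx.2⟩ ⟨y, trivial, (h hy).2⟩
    have : Nonempty (⊤ ⊓ (chart f j ⊓ chart f l) : T.Opens) := ⟨⟨z, trivial, hzj, hzl⟩⟩
    have rel := s.2 j l
    rw [show (-e).toNat = 0 by omega, pow_zero, one_smul, hl, map_zero, smul_zero] at rel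
    exact map_injective_of_isIntegral T
      (homOfLE (inf_le_inf_left ⊤ inf_le_left : ⊤ ⊓ (chart f j ⊓ chart f l) ≤ ⊤ ⊓ chart f j))
      (rel.symm.trans (map_zero _).symm)

lemma vanishingIdeal_lt_ker_divisorι_app (i : X ⟶ ProjSpace k N) (hY : IsIrreducible (Y : Set X))
    {e : ℤ} (he : 0 ≤ e) {C : (reducedScheme Y).IdealSheafData}
    (hC : MemLinearSystem (reducedι Y ≫ i) e C) {l : Fin (N + 1)} {V : X.affineOpens}
    (hVl : V.1 ≤ chart i l) {p : X} (hp : p ∈ Y) (hpV : p ∈ V.1) :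
    (Scheme.IdealSheafData.vanishingIdeal Y).ideal V <
      RingHom.ker ((divisorι Y C).app V.1).hom := by
  have := isIntegral_reducedScheme hY
  obtain ⟨t, rfl⟩ := exists_reducedι_eq hp
  obtain ⟨s, hs, hsC⟩ := hC
  let V' : (reducedScheme Y).affineOpens := ⟨_, V.2.preimage (reducedι Y)⟩
  have hV' : V'.1 ≤ ⊤ ⊓ chart (reducedι Y ≫ i) l := fun x hx ↦ ⟨trivial, hVl hx⟩
  have : Nonempty V'.1 := ⟨⟨t, hpV⟩⟩
  obtain ⟨g, hg⟩ := (Scheme.IdealSheafData.vanishingIdeal Y).subschemeι_app_surjective V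
    ((reducedScheme Y).presheaf.map (homOfLE hV').op
      (s.1 l : Γ(reducedScheme Y, ⊤ ⊓ chart (reducedι Y ≫ i) l)))
  rw [ker_divisorι_app, ← Scheme.IdealSheafData.ker_subschemeι_app]
  refine lt_of_le_of_ne (Ideal.comap_mono bot_le) fun heq ↦ ?_
  have hgC : g ∈ (C.ideal V').comap ((reducedι Y).app V.1).hom := by
    rw [Ideal.mem_comap, hsC l V' hV']
    exact Ideal.mem_span_singleton.2 hg.symm.dvd
  rw [← heq] at hgC
  exact hs (section_eq_zero_of_res_eq_zero (reducedι Y ≫ i) he l hV' (hg.symm.trans hgC))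

/- Near a point where it is free, the ideal of `C` is principal and strictly contains the prime
ideal of `Y`, so that the latter vanishes after localization. -/
lemma exists_ideal_eq_bot_of_isLocallyFreeAt [IsLocallyNoetherian X] (i : X ⟶ ProjSpace k N)
    (hY : IsIrreducible (Y : Set X)) {e : ℤ} (he : 0 ≤ e) {C : (reducedScheme Y).IdealSheafData}
    (hC : MemLinearSystem (reducedι Y ≫ i) e C) {p : X} (hp : p ∈ Set.range (divisorι Y C))
    (h : IsLocallyFreeAt (idealModule (divisorι Y C)) p) :
    ∃ V : X.affineOpens, p ∈ V.1 ∧ (Scheme.IdealSheafData.vanishingIdeal Y).ideal V = ⊥ := by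
  have hpY : p ∈ Y := range_divisorι_subset C hp
  obtain ⟨U, hpU, hU⟩ := exists_free_sections_of_isLocallyFreeAt h
  obtain ⟨l, hl⟩ := exists_mem_chart i p
  obtain ⟨V, hV, hpV, hVU⟩ := exists_isAffineOpen_mem_and_subset (U := U ⊓ chart i l) ⟨hpU, hl⟩
  have := hU V (hVU.trans inf_le_left)
  have : Module.Free Γ(X, V) (RingHom.ker ((divisorι Y C).app V).hom) :=
    .of_equiv (idealSectionsEquiv (divisorι Y C) V)
  have : Nonempty V := ⟨⟨p, hpV⟩⟩
  obtain ⟨a, ha, haY⟩ := exists_ideal_eq_bot_of_lt_isPrincipal (V := ⟨V, hV⟩)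
    (isPrime_vanishingIdeal hY _ hpY hpV) (isPrincipal_of_free _)
    (vanishingIdeal_lt_ker_divisorι_app i hY he hC (hVU.trans inf_le_right) hpY hpV)
  refine ⟨X.affineBasicOpen a, ?_, haY⟩
  obtain ⟨c, rfl⟩ := hp
  have h1 : (divisorι Y C).app V a = 1 := by
    have := RingHom.mem_ker.1 ha
    rwa [map_sub, map_one, sub_eq_zero] at this
  have h2 := Scheme.preimage_basicOpen (divisorι Y C) a
  rw [h1, Scheme.basicOpen_one] at h2
  exact h2.ge hpV

end Divisor

section MultiplicityOne

variable {X : Scheme.{u}} {Y : Closeds X}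

lemma mem_minimalPrimes_of_mem_associatedPrimes [IsLocallyNoetherian X]
    (hCM : IsCohenMacaulay X) (V : X.affineOpens) {Q : Ideal Γ(X, V.1)}
    (hQ : Q ∈ associatedPrimes Γ(X, V.1) Γ(X, V.1)) :
    Q ∈ minimalPrimes Γ(X, V.1) := by
  have hQp : Q.IsPrime := hQ.isPrime
  let q : PrimeSpectrum Γ(X, V.1) := ⟨Q, hQp⟩
  let z : V.1 := ⟨V.2.fromSpec q, V.2.range_fromSpec.subset ⟨q, rfl⟩⟩
  let := (X.presheaf.germ V.1 _ z.2).hom.toAlgebra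
  have : IsLocalization.AtPrime (X.presheaf.stalk z.1) Q := V.2.isLocalization_stalk' q z.2
  have h := hCM z.1
  rw [depth_eq_zero_of_mem_associatedPrimes Q hQ,
    IsLocalization.AtPrime.ringKrullDim_eq_height Q] at h
  rw [← Ideal.height_eq_zero_iff]
  exact_mod_cast h.symm

lemma le_of_fromSpec_mem {V : X.affineOpens} (q : PrimeSpectrum Γ(X, V.1))
    (hq : V.2.fromSpec q ∈ Y) : (Scheme.IdealSheafData.vanishingIdeal Y).ideal V ≤ q.asIdeal := by
  intro x hx
  rw [Scheme.IdealSheafData.vanishingIdeal_ideal, PrimeSpectrum.mem_vanishingIdeal] at hx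
  exact hx q hq

lemma exists_mul_eq_zero_of_hasMultiplicityOne (hY : IsIrreducible (Y : Set X))
    (hm : HasMultiplicityOne Y) {V : X.affineOpens} {p : X} (hp : p ∈ Y) (hpV : p ∈ V.1)
    {x : Γ(X, V.1)} (hx : x ∈ (Scheme.IdealSheafData.vanishingIdeal Y).ideal V) :
    ∃ m ∉ (Scheme.IdealSheafData.vanishingIdeal Y).ideal V, m * x = 0 := by
  have := isIntegral_reducedScheme hY
  obtain ⟨U, ⟨t₁, ht₁⟩, hU⟩ := hm
  obtain ⟨t₂, rfl⟩ := exists_reducedι_eq hp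
  obtain ⟨t, -, htU, htV⟩ := (PreirreducibleSpace.isPreirreducible_univ (X := reducedScheme Y)) _ _
    U.2 (reducedι Y ⁻¹ᵁ V.1).2 ⟨t₁, trivial, ht₁⟩ ⟨t₂, trivial, hpV⟩
  have hgerm : X.presheaf.germ V.1 (reducedι Y t) htV x = 0 := by
    refine (injective_iff_map_eq_zero _).1 (hU t htU).1 _ ?_
    refine ((reducedι Y).germ_stalkMap_apply V.1 t htV x).trans ?_
    rw [← Scheme.IdealSheafData.ker_subschemeι_app, RingHom.mem_ker] at hx
    exact (congrArg _ hx).trans (map_zero _)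
  let q := V.2.primeIdealOf ⟨reducedι Y t, htV⟩
  let := (X.presheaf.germ V.1 (reducedι Y t) htV).hom.toAlgebra
  have : IsLocalization.AtPrime (X.presheaf.stalk (reducedι Y t)) q.asIdeal :=
    V.2.isLocalization_stalk ⟨_, htV⟩
  obtain ⟨m, hm⟩ := (IsLocalization.map_eq_zero_iff q.asIdeal.primeCompl
    (X.presheaf.stalk (reducedι Y t)) x).1 hgerm
  refine ⟨m.1, fun h ↦ m.2 (le_of_fromSpec_mem q ?_ h), hm⟩
  rw [V.2.fromSpec_primeIdealOf]
  exact reducedι_mem Y t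

/- Cohen–Macaulay local rings have no embedded primes, so the annihilator of a nonzero function
vanishing on `Y` would lie in a minimal prime, which is the ideal of `Y`. -/
lemma ideal_eq_bot_of_subset [IsLocallyNoetherian X] (hCM : IsCohenMacaulay X)
    (hY : IsIrreducible (Y : Set X)) (hm : HasMultiplicityOne Y) {V : X.affineOpens}
    (hV : (V.1 : Set X) ⊆ Y) : (Scheme.IdealSheafData.vanishingIdeal Y).ideal V = ⊥ := by
  have : IsNoetherianRing Γ(X, V.1) := IsLocallyNoetherian.component_noetherian V
  refine eq_bot_iff.2 fun x hx ↦ by_contra fun hx0 ↦ ?_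
  obtain ⟨Q, hQ, hxQ⟩ := exists_le_isAssociatedPrime_of_isNoetherianRing Γ(X, V.1) x hx0
  have hQp : Q.IsPrime := hQ.isPrime
  have hp : V.2.fromSpec ⟨Q, hQp⟩ ∈ V.1 := V.2.range_fromSpec.subset ⟨_, rfl⟩
  obtain ⟨m, hmY, hmx⟩ := exists_mul_eq_zero_of_hasMultiplicityOne hY hm (hV hp) hp hx
  exact hmY ((mem_minimalPrimes_of_mem_associatedPrimes hCM V hQ).2
    ⟨isPrime_vanishingIdeal hY V (hV hp) hp, bot_le⟩ (le_of_fromSpec_mem _ (hV hp))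
    (hxQ (Submodule.mem_colon_singleton.2 hmx)))

lemma isIntegral_of_eq_univ [IsLocallyNoetherian X] (hCM : IsCohenMacaulay X)
    (hY : IsIrreducible (Y : Set X)) (hm : HasMultiplicityOne Y) (h : (Y : Set X) = Set.univ) :
    IsIntegral X := by
  have hbot : Scheme.IdealSheafData.vanishingIdeal Y = ⊥ := by
    ext V : 2
    exact ideal_eq_bot_of_subset hCM hY hm (h ▸ Set.subset_univ _)
  have := isIntegral_reducedScheme hY
  have : IsIso (reducedι Y) := (Scheme.isIso_subschemeι_iff_eq_bot _).2 hbot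
  have : Nonempty X := hY.nonempty.to_type
  exact isIntegral_of_isOpenImmersion (inv (reducedι Y))

lemma subset_of_ideal_eq_bot {V : X.affineOpens}
    (h : (Scheme.IdealSheafData.vanishingIdeal Y).ideal V = ⊥) : (V.1 : Set X) ⊆ Y := by
  intro x hx
  rw [← Scheme.IdealSheafData.coe_support_vanishingIdeal Y, SetLike.mem_coe,
    Scheme.IdealSheafData.mem_support_iff_of_mem (U := V) hx, h]
  simp

lemma coe_support_residualIntersection [IsNoetherian X] :
    ((residualIntersection Y).support : Set X) = (Y : Set X) ∩ closure (Y : Set X)ᶜ := by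
  rw [residualIntersection, Scheme.IdealSheafData.support_sup, Closeds.coe_inf,
    Scheme.IdealSheafData.coe_support_vanishingIdeal, Scheme.Hom.support_ker,
    Scheme.Opens.range_ι]
  rfl

variable {k : Type u} [Field k] {N : ℕ}

lemma isLocallyFreeAt_of_ideal_eq_bot (i : X ⟶ ProjSpace k N) (hY : IsIrreducible (Y : Set X))
    {e : ℤ} (he : 0 ≤ e) {C : (reducedScheme Y).IdealSheafData}
    (hC : MemLinearSystem (reducedι Y ≫ i) e C) {l : Fin (N + 1)} {V : X.affineOpens}
    (hVl : V.1 ≤ chart i l) (hV : (Scheme.IdealSheafData.vanishingIdeal Y).ideal V = ⊥)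
    {p : X} (hp : p ∈ V.1) : IsLocallyFreeAt (idealModule (divisorι Y C)) p := by
  have := isIntegral_reducedScheme hY
  obtain ⟨t, rfl⟩ := exists_reducedι_eq (subset_of_ideal_eq_bot hV hp)
  obtain ⟨s, hs, hsC⟩ := hC
  let V' : (reducedScheme Y).affineOpens := ⟨_, V.2.preimage (reducedι Y)⟩
  have hV' : V'.1 ≤ ⊤ ⊓ chart (reducedι Y ≫ i) l := fun x hx ↦ ⟨trivial, hVl hx⟩
  have : Nonempty V'.1 := ⟨⟨t, hp⟩⟩
  have hbij : Function.Bijective ((reducedι Y).app V.1).hom := by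
    refine ⟨?_, Scheme.IdealSheafData.subschemeι_app_surjective _ V⟩
    rw [RingHom.injective_iff_ker_eq_bot, Scheme.IdealSheafData.ker_subschemeι_app, hV]
  obtain ⟨g, hg⟩ := hbij.2 ((reducedScheme Y).presheaf.map (homOfLE hV').op
    (s.1 l : Γ(reducedScheme Y, ⊤ ⊓ chart (reducedι Y ≫ i) l)))
  have : IsDomain Γ(X, V.1) := hbij.1.isDomain _
  refine isLocallyFreeAt_of_ker_app_eq_span _ (g := g) (mem_nonZeroDivisors_of_ne_zero ?_) ?_ hp
  · rintro rfl
    exact hs (section_eq_zero_of_res_eq_zero (reducedι Y ≫ i) he l hV'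
      (hg.symm.trans (map_zero _)))
  · rw [ker_divisorι_app, hsC l V' hV', ← hg, ← Set.image_singleton, ← Ideal.map_span]
    exact Ideal.comap_map_of_bijective _ hbij

lemma nonLocallyFreeLocus_eq [IsNoetherian X] (i : X ⟶ ProjSpace k N)
    (hCM : IsCohenMacaulay X) (hY : IsIrreducible (Y : Set X)) (hm : HasMultiplicityOne Y) {e : ℤ}
    (he : 0 ≤ e) {C : (reducedScheme Y).IdealSheafData}
    (hC : MemLinearSystem (reducedι Y ≫ i) e C) :
    nonLocallyFreeLocus Y C =
      ((residualIntersection Y).support : Set X) ∩ Set.range (divisorι Y C) := by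
  rw [coe_support_residualIntersection]
  ext p
  constructor
  · refine fun hp ↦ ⟨⟨hp.1, by_contra fun h ↦ hp.2 ?_⟩, nonLocallyFreeLocus_subset_range C hp⟩
    obtain ⟨l, hl⟩ := exists_mem_chart i p
    obtain ⟨V, hV, hpV, hVU⟩ := exists_isAffineOpen_mem_and_subset
      (U := ⟨(closure (Y : Set X)ᶜ)ᶜ, isClosed_closure.isOpen_compl⟩ ⊓ chart i l) ⟨h, hl⟩
    have hVY : (V : Set X) ⊆ Y := fun x hx ↦ not_not.1 fun h ↦ (hVU hx).1 (subset_closure h)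
    exact isLocallyFreeAt_of_ideal_eq_bot i hY he hC (V := ⟨V, hV⟩) (fun x hx ↦ (hVU hx).2)
      (ideal_eq_bot_of_subset hCM hY hm hVY) hpV
  · rintro ⟨⟨hpY, hp⟩, hpC⟩
    refine ⟨hpY, fun hfree ↦ ?_⟩
    obtain ⟨V, hpV, hV⟩ := exists_ideal_eq_bot_of_isLocallyFreeAt i hY he hC hpC hfree
    obtain ⟨z, hzV, hz⟩ := mem_closure_iff.1 hp _ V.1.2 hpV
    exact hz (subset_of_ideal_eq_bot hV hzV)

end MultiplicityOne

section Components

variable {T : Type*} [TopologicalSpace T]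

lemma isIrreducible_image_iff {S : Type*} [TopologicalSpace S] {j : S → T}
    (hj : Topology.IsEmbedding j) {W : Set S} : IsIrreducible (j '' W) ↔ IsIrreducible W := by
  rw [isIrreducible_iff_irreducibleSpace, isIrreducible_iff_irreducibleSpace]
  exact (hj.homeomorphImage W).irreducibleSpace_iff.symm

lemma topologicalKrullDim_image {S : Type*} [TopologicalSpace S] {j : S → T}
    (hj : Topology.IsEmbedding j) (W : Set S) :
    topologicalKrullDim (j '' W) = topologicalKrullDim W :=
  (IsHomeomorph.topologicalKrullDim_eq _ (hj.homeomorphImage W).isHomeomorph).symm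

lemma topologicalKrullDim_range {S : Type*} [TopologicalSpace S] {j : S → T}
    (hj : Topology.IsEmbedding j) : topologicalKrullDim (Set.range j) = topologicalKrullDim S :=
  (IsHomeomorph.topologicalKrullDim_eq _ hj.toHomeomorph.isHomeomorph).symm

lemma maximal_image_of_mem_irreducibleComponents {S : Type*} [TopologicalSpace S] {j : S → T}
    (hj : Topology.IsEmbedding j) {W : Set S} (hW : W ∈ irreducibleComponents S) :
    Maximal (fun V ↦ IsIrreducible V ∧ V ⊆ Set.range j) (j '' W) := by
  refine ⟨⟨(isIrreducible_image_iff hj).2 hW.1, Set.image_subset_range _ _⟩, ?_⟩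
  rintro V ⟨hV, hVj⟩ hWV
  obtain ⟨V, rfl⟩ := Set.subset_range_iff_exists_image_eq.1 hVj
  exact Set.image_mono
    (hW.2 ((isIrreducible_image_iff hj).1 hV) ((Set.image_subset_image_iff hj.injective).1 hWV))

lemma exists_closure_singleton_eq_of_maximal [QuasiSober T] [T0Space T] {F W : Set T}
    (hF : IsClosed F) (hW : Maximal (fun S ↦ IsIrreducible S ∧ S ⊆ F) W) :
    ∃ x ∈ F, closure {x} = W ∧ ∀ y ∈ F, y ⤳ x → y = x := by
  have hWcl : IsClosed W := isClosed_of_closure_subset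
    (hW.2 ⟨hW.1.1.closure, closure_minimal hW.1.2 hF⟩ subset_closure)
  obtain ⟨x, hx⟩ := QuasiSober.sober hW.1.1 hWcl
  refine ⟨x, hW.1.2 hx.mem, hx, fun y hy hyx ↦ IsGenericPoint.eq ?_ hx⟩
  have hle : W ⊆ closure {y} := hx.def ▸ hyx.closure_subset
  exact (hW.2 ⟨isIrreducible_singleton.closure,
    closure_minimal (Set.singleton_subset_iff.2 hy) hF⟩ hle).antisymm hle

variable {Y : Set T}

lemma exists_irreducibleComponent_of_mem_closure_compl [NoetherianSpace T] {x : T}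
    (hx : x ∈ closure Yᶜ) : ∃ W ∈ irreducibleComponents T, W ≠ Y ∧ x ∈ W := by
  have hfin : (irreducibleComponents T \ {Y}).Finite :=
    NoetherianSpace.finite_irreducibleComponents.subset Set.sdiff_subset
  have hcl : IsClosed (⋃₀ (irreducibleComponents T \ {Y})) :=
    Set.sUnion_eq_biUnion ▸ hfin.isClosed_biUnion fun W hW ↦
      isClosed_of_mem_irreducibleComponents W hW.1
  have hle : Yᶜ ⊆ ⋃₀ (irreducibleComponents T \ {Y}) := fun z hz ↦
    ⟨irreducibleComponent z, ⟨irreducibleComponent_mem_irreducibleComponents z,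
      fun h ↦ hz (h ▸ mem_irreducibleComponent)⟩, mem_irreducibleComponent⟩
  obtain ⟨W, hW, hxW⟩ := closure_minimal hle hcl hx
  exact ⟨W, hW.1, hW.2, hxW⟩

lemma exists_specializes_notMem [NoetherianSpace T] [QuasiSober T]
    (hY : Y ∈ irreducibleComponents T) {x : T} (hx : x ∈ closure Yᶜ) : ∃ y, y ⤳ x ∧ y ∉ Y := by
  obtain ⟨W, hW, hne, hxW⟩ := exists_irreducibleComponent_of_mem_closure_compl hx
  obtain ⟨y, hy⟩ := QuasiSober.sober hW.1 (isClosed_of_mem_irreducibleComponents W hW)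
  refine ⟨y, hy.specializes hxW, fun hyY ↦ hne ?_⟩
  have hle : W ⊆ Y :=
    (hy.mem_closed_set_iff (isClosed_of_mem_irreducibleComponents Y hY)).1 hyY
  exact hle.antisymm (hW.2 hY.1 hle)

lemma notMem_closure_compl_of_isGenericPoint [NoetherianSpace T]
    (hY : Y ∈ irreducibleComponents T) {y : T} (hy : IsGenericPoint y Y) : y ∉ closure Yᶜ := by
  intro h
  obtain ⟨W, hW, hne, hyW⟩ := exists_irreducibleComponent_of_mem_closure_compl h
  have hle : Y ⊆ W := (hy.mem_closed_set_iff (isClosed_of_mem_irreducibleComponents W hW)).1 hyW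
  exact hne ((hY.2 hW.1 hle).antisymm hle)

end Components

section Residual

variable {X : Scheme.{u}} [IsNoetherian X] {Y : Closeds X}

lemma range_subschemeι_residualIntersection :
    Set.range (residualIntersection Y).subschemeι = (Y : Set X) ∩ closure (Y : Set X)ᶜ := by
  rw [Scheme.IdealSheafData.range_subschemeι, coe_support_residualIntersection]

/- Otherwise the local ring has depth at least two, and its punctured spectrum, being connected,
lies in `Y` or in the closure of the complement of `Y`. -/
lemma ringKrullDim_stalk_le_one (hCM : IsCohenMacaulay X)
    (hY : (Y : Set X) ∈ irreducibleComponents X) {x : X}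
    (hx : x ∈ (Y : Set X) ∩ closure (Y : Set X)ᶜ)
    (hgen : ∀ y ∈ (Y : Set X) ∩ closure (Y : Set X)ᶜ, y ⤳ x → y = x) :
    ringKrullDim (X.presheaf.stalk x) ≤ 1 := by
  rw [← hCM x]
  by_contra hlt
  have hdepth : 2 ≤ depth (X.presheaf.stalk x) :=
    Order.add_one_le_of_lt (not_le.1 fun h ↦ hlt (by exact_mod_cast h))
  let φ := X.fromSpecStalk x
  have hφ (y : X) : y ∈ Set.range φ ↔ y ⤳ x := by rw [Scheme.range_fromSpecStalk]; rfl
  have hinter : φ ⁻¹' Y ∩ φ ⁻¹' closure (Y : Set X)ᶜ ⊆ {IsLocalRing.closedPoint _} := fun q hq ↦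
    φ.isEmbedding.injective
      ((hgen _ hq ((hφ _).1 ⟨q, rfl⟩)).trans Scheme.fromSpecStalk_closedPoint.symm)
  have hunion : φ ⁻¹' Y ∪ φ ⁻¹' closure (Y : Set X)ᶜ = Set.univ :=
    Set.eq_univ_of_forall fun q ↦ (em (φ q ∈ (Y : Set X))).imp id fun h ↦ subset_closure h
  rcases eq_univ_or_eq_univ_of_two_le_depth hdepth (Y.isClosed.preimage φ.continuous)
    (isClosed_closure.preimage φ.continuous) hunion hinter with h | h
  · obtain ⟨y, hyx, hyY⟩ := exists_specializes_notMem hY hx.2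
    obtain ⟨q, rfl⟩ := (hφ y).2 hyx
    exact hyY (h.ge (Set.mem_univ q))
  · obtain ⟨y, hy⟩ := QuasiSober.sober hY.1 Y.isClosed
    obtain ⟨q, rfl⟩ := (hφ y).2 (hy.specializes hx.1)
    exact notMem_closure_compl_of_isGenericPoint hY hy (h.ge (Set.mem_univ q))

lemma topologicalKrullDim_closure_singleton_add_one {k : Type u} [Field k] (f : X ⟶ Spec (.of k))
    [LocallyOfFiniteType f] (hCM : IsCohenMacaulay X)
    (hY : (Y : Set X) ∈ irreducibleComponents X) {x : X}
    (hx : x ∈ (Y : Set X) ∩ closure (Y : Set X)ᶜ)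
    (hgen : ∀ y ∈ (Y : Set X) ∩ closure (Y : Set X)ᶜ, y ⤳ x → y = x) :
    topologicalKrullDim (closure {x} : Set X) + 1 = topologicalKrullDim (Y : Set X) := by
  have hι := (reducedι Y).isClosedEmbedding
  have hI := isIntegral_reducedScheme hY.1
  obtain ⟨t, rfl⟩ := exists_reducedι_eq hx.1
  have hclosure : reducedι Y '' closure {t} = closure {reducedι Y t} := by
    rw [← hι.closure_image_eq, Set.image_singleton]
  have hdim : ringKrullDim ((reducedScheme Y).presheaf.stalk t) ≤ 1 :=
    (ringKrullDim_le_of_surjective _ ((reducedι Y).stalkMap_surjective t)).trans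
      (ringKrullDim_stalk_le_one hCM hY hx hgen)
  have hne : closure {t} ≠ (Set.univ : Set (reducedScheme Y)) := fun h ↦ by
    rw [h, Set.image_univ, range_reducedι] at hclosure
    exact notMem_closure_compl_of_isGenericPoint hY hclosure.symm hx.2
  rw [← hclosure, topologicalKrullDim_image hι.isEmbedding, ← range_reducedι,
    topologicalKrullDim_range hι.isEmbedding]
  exact (topologicalKrullDim_add_one_le isClosed_closure hne).antisymm
    (topologicalKrullDim_le_closure_add_one (reducedι Y ≫ f) t hdim)

lemma isPureDim_residualIntersection {k : Type u} [Field k] (f : X ⟶ Spec (.of k))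
    [LocallyOfFiniteType f] (hCM : IsCohenMacaulay X)
    (hY : (Y : Set X) ∈ irreducibleComponents X) {n : ℕ}
    (hdim : topologicalKrullDim (Y : Set X) = (n + 1 : ℕ)) :
    IsPureDim (residualIntersection Y).subscheme n := by
  intro W hW
  have hφ := (residualIntersection Y).subschemeι.isClosedEmbedding.isEmbedding
  have hmax := maximal_image_of_mem_irreducibleComponents hφ hW
  rw [range_subschemeι_residualIntersection] at hmax
  obtain ⟨x, hx, hxW, hgen⟩ :=
    exists_closure_singleton_eq_of_maximal (Y.isClosed.inter isClosed_closure) hmax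
  have key := topologicalKrullDim_closure_singleton_add_one f hCM hY hx hgen
  rw [hxW, topologicalKrullDim_image hφ, hdim] at key
  generalize topologicalKrullDim W = d at key ⊢
  induction d using WithBot.recBotCoe with
  | bot => exact (WithBot.bot_ne_natCast _ key).elim
  | coe a =>
    have hadd : a + 1 = (n : ℕ∞) + 1 := by exact_mod_cast key
    exact congrArg _ (ENat.add_left_injective_of_ne_top ENat.one_ne_top hadd)

lemma nonempty_residualIntersection [PreconnectedSpace X] (hY : (Y : Set X).Nonempty)
    (hne : (Y : Set X) ≠ Set.univ) : Nonempty (residualIntersection Y).subscheme := by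
  rw [← Set.range_nonempty_iff_nonempty (f := (residualIntersection Y).subschemeι),
    range_subschemeι_residualIntersection, Set.nonempty_iff_ne_empty]
  intro h
  have hcl : IsClosed (Y : Set X)ᶜ := isClosed_of_closure_subset fun x hx hxY ↦
    h.le ⟨hxY, hx⟩
  rcases isClopen_iff.1 (⟨Y.isClosed, isClosed_compl_iff.1 hcl⟩ : IsClopen (Y : Set X)) with h | h
  exacts [hY.ne_empty h, hne h]

end Residual

section Ample

variable {k : Type u} [Field k] {N : ℕ} {Z : Scheme.{u}}

/-- The functions `u j` on the charts are the coordinates of a section of `𝒪_Z(m)`, `m ≥ 0`: the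
products `u_j X_j ^ m` agree on the overlaps. Compared with `twistSections`, it is phrased in terms
of functions, so that nowhere vanishing sections can be inverted. -/
def IsTwistSection (f : Z ⟶ ProjSpace k N) (m : ℕ) (u : ∀ j, Γ(Z, chart f j)) : Prop :=
  ∀ j l, ratioOn f j l (W := chart f j ⊓ chart f l) inf_le_left ^ m *
      (Z.presheaf.map (homOfLE inf_le_right).op).hom (u l) =
    (Z.presheaf.map (homOfLE inf_le_left).op).hom (u j)

lemma appLE_ratioOn {D : Scheme.{u}} (g : D ⟶ Z) (f : Z ⟶ ProjSpace k N) (j l) {W : Z.Opens}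
    (hW : W ≤ chart f j) {W' : D.Opens} (h : W' ≤ g ⁻¹ᵁ W) (h' : W' ≤ chart (g ≫ f) j) :
    (g.appLE W W' h).hom (ratioOn f j l hW) = ratioOn (g ≫ f) j l h' :=
  ConcreteCategory.congr_hom (Scheme.Hom.appLE_comp_appLE g f (coordOpen k N j) W W' hW h) _

lemma map_appLE_apply {D : Scheme.{u}} (g : D ⟶ Z) {U V : Z.Opens} {U' V' : D.Opens} (h : V ≤ U)
    (hU : U' ≤ g ⁻¹ᵁ U) (hV : V' ≤ g ⁻¹ᵁ V) (h' : V' ≤ U') (x : Γ(Z, U)) :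
    (D.presheaf.map (homOfLE h').op).hom ((g.appLE U U' hU).hom x) =
      (g.appLE V V' hV).hom ((Z.presheaf.map (homOfLE h).op).hom x) :=
  ConcreteCategory.congr_hom
    ((g.appLE_map hU (homOfLE h').op).trans (g.map_appLE hV (homOfLE h).op).symm) x

lemma le_preimage_top_inf_chart {D : Scheme.{u}} (g : D ⟶ Z) (f : Z ⟶ ProjSpace k N) (j) :
    chart (g ≫ f) j ≤ g ⁻¹ᵁ (⊤ ⊓ chart f j) :=
  fun _ hx ↦ ⟨trivial, hx⟩

lemma isTwistSection_appLE {D : Scheme.{u}} (g : D ⟶ Z) (f : Z ⟶ ProjSpace k N) {e : ℤ}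
    (he : 0 ≤ e) (s : twistSections f (structureModule Z) e ⊤) :
    IsTwistSection (g ≫ f) e.toNat fun j ↦
      (g.appLE _ _ (le_preimage_top_inf_chart g f j)).hom (s.1 j : Γ(Z, ⊤ ⊓ chart f j)) := by
  intro j l
  have hle : chart (g ≫ f) j ⊓ chart (g ≫ f) l ≤ g ⁻¹ᵁ (⊤ ⊓ (chart f j ⊓ chart f l)) :=
    fun x hx ↦ ⟨trivial, hx⟩
  have rel := s.2 j l
  rw [show (-e).toNat = 0 by omega, pow_zero, one_smul] at rel
  have h := congrArg (g.appLE _ _ hle).hom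
    (show (ratioOn f j l (inf_le_right.trans inf_le_left) ^ e.toNat *
      (Z.presheaf.map (homOfLE (inf_le_inf_left ⊤ inf_le_right)).op).hom
        (s.1 l : Γ(Z, ⊤ ⊓ chart f l)) : Γ(Z, ⊤ ⊓ (chart f j ⊓ chart f l))) =
      (Z.presheaf.map (homOfLE (inf_le_inf_left ⊤ inf_le_left)).op).hom
        (s.1 j : Γ(Z, ⊤ ⊓ chart f j)) from rel)
  rw [map_mul, map_pow, appLE_ratioOn g f j l _ _ inf_le_left] at h
  exact (congrArg (_ * ·) (map_appLE_apply g (inf_le_inf_left ⊤ inf_le_right)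
    (le_preimage_top_inf_chart g f l) hle inf_le_right _)).trans (h.trans
    (map_appLE_apply g (inf_le_inf_left ⊤ inf_le_left)
      (le_preimage_top_inf_chart g f j) hle inf_le_left _).symm)

variable {f : Z ⟶ ProjSpace k N} {m : ℕ} {u : ∀ j, Γ(Z, chart f j)}

lemma IsTwistSection.map_ratioOn_pow_mul_eq (hs : IsTwistSection f m u)
    {v : ∀ j, Γ(Z, chart f j)} (hv : ∀ j, v j * u j = 1) (a b l : Fin (N + 1)) :
    (Z.presheaf.map (homOfLE (inf_le_left : chart f a ⊓ chart f b ≤ _)).op).hom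
        (ratioOn f a l le_rfl ^ m * v a) =
      (Z.presheaf.map (homOfLE inf_le_right).op).hom (ratioOn f b l le_rfl ^ m * v b) := by
  let V := chart f a ⊓ chart f b
  have hVa : V ≤ chart f a := inf_le_left
  have hVb : V ≤ chart f b := inf_le_right
  have ha := congrArg (Z.presheaf.map (homOfLE hVa).op).hom (hv a)
  have hb := congrArg (Z.presheaf.map (homOfLE hVb).op).hom (hv b)
  rw [map_mul, map_one] at ha hb
  rw [← hs a b] at ha
  rw [map_mul, map_mul, map_pow, map_pow, map_ratioOn, map_ratioOn,
    ratioOn_mul f a b l hVa hVb, mul_pow]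
  linear_combination
    (ratioOn f b l hVb ^ m * (Z.presheaf.map (homOfLE hVb).op).hom (v b)) * ha -
    (ratioOn f b l hVb ^ m * ratioOn f a b hVa ^ m *
      (Z.presheaf.map (homOfLE hVa).op).hom (v a)) * hb

/- The global function `r` is `X_l ^ m / s`, where `s` is the section with coordinates `u`. -/
lemma IsTwistSection.exists_mul_eq_ratioOn_pow (hs : IsTwistSection f m u)
    (hu : ∀ j, IsUnit (u j)) (l : Fin (N + 1)) :
    ∃ r : Γ(Z, ⊤), ∀ j, (Z.presheaf.map (homOfLE (le_top : chart f j ≤ ⊤)).op).hom r * u j =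
      ratioOn f j l le_rfl ^ m := by
  choose v hv using fun j ↦ (hu j).exists_left_inv
  let U (j : ULift.{u} (Fin (N + 1))) : Z.Opens := chart f j.down
  let sf (j) : Γ(Z, U j) := ratioOn f j.down l le_rfl ^ m * v j.down
  have hcov : (⊤ : Z.Opens) ≤ iSup U := fun x _ ↦ by
    obtain ⟨j, hj⟩ := exists_mem_chart f x
    exact Opens.mem_iSup.2 ⟨⟨j⟩, hj⟩
  obtain ⟨r, hr, -⟩ := Z.sheaf.existsUnique_gluing' U ⊤ (fun j ↦ homOfLE le_top) hcov sf
    fun a b ↦ hs.map_ratioOn_pow_mul_eq hv a.down b.down l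
  refine ⟨r, fun j ↦ ?_⟩
  rw [show (Z.presheaf.map (homOfLE (le_top : chart f j ≤ ⊤)).op).hom r =
    ratioOn f j l le_rfl ^ m * v j from hr ⟨j⟩, mul_assoc, hv, mul_one]

lemma IsTwistSection.exists_chart_eq_top [Nonempty Z] (hF : IsField Γ(Z, ⊤))
    (hs : IsTwistSection f m u) (hm : m ≠ 0) (hu : ∀ j, IsUnit (u j)) : ∃ l, chart f l = ⊤ := by
  obtain ⟨z⟩ := ‹Nonempty Z›
  obtain ⟨l, hl⟩ := exists_mem_chart f z
  have : Nonempty (chart f l) := ⟨⟨z, hl⟩⟩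
  obtain ⟨r, hr⟩ := hs.exists_mul_eq_ratioOn_pow hu l
  have hr0 : r ≠ 0 := by
    rintro rfl
    have h := hr l
    rw [map_zero, zero_mul, ratioOn_self, one_pow] at h
    exact zero_ne_one h
  have hunit : IsUnit r := .of_mul_eq_one _ (hF.mul_inv_cancel hr0).choose_spec
  refine ⟨l, eq_top_iff.2 fun x _ ↦ ?_⟩
  obtain ⟨j, hj⟩ := exists_mem_chart f x
  have hratio : IsUnit (ratioOn f j l (le_rfl : chart f j ≤ _)) :=
    (isUnit_pow_iff hm).1 (hr j ▸ (hunit.map _).mul (hu j))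
  exact basicOpen_ratioOn_le f j l le_rfl ((Scheme.basicOpen_of_isUnit _ hratio).ge hj)

lemma IsTwistSection.topologicalKrullDim_eq_zero [IsIntegral Z] [IsClosedImmersion f]
    (hs : IsTwistSection f m u) (hm : m ≠ 0) (hu : ∀ j, IsUnit (u j)) :
    topologicalKrullDim Z = 0 := by
  have hF : IsField Γ(Z, ⊤) := isField_of_universallyClosed k (f ≫ projToSpec k N)
  obtain ⟨l, hl⟩ := hs.exists_chart_eq_top hF hm hu
  rw [← IsHomeomorph.topologicalKrullDim_eq _ (Homeomorph.Set.univ Z).isHomeomorph]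
  exact (topologicalKrullDim_eq_ringKrullDim (hl ▸ isAffineOpen_chart f l)).trans
    (ringKrullDim_eq_zero_of_isField hF)

end Ample

section Meet

variable {k : Type u} [Field k] {N : ℕ}

lemma isUnit_appLE_of_notMem_support {T D : Scheme.{u}} (g : D ⟶ T) {C : T.IdealSheafData}
    {U : T.Opens} {a : Γ(T, U)}
    (hC : ∀ (V : T.affineOpens) (h : V.1 ≤ U),
      C.ideal V = Ideal.span {(T.presheaf.map (homOfLE h).op).hom a})
    (hg : ∀ z, g z ∉ C.support) {W : D.Opens} (hW : W ≤ g ⁻¹ᵁ U) :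
    IsUnit ((g.appLE U W hW).hom a) := by
  refine D.toRingedSpace.isUnit_of_isUnit_germ W _ fun z hz ↦ (D.mem_basicOpen _ z hz).1 ?_
  obtain ⟨V, hV, hzV, hVU⟩ := exists_isAffineOpen_mem_and_subset (x := g z) (U := U) (hW hz)
  have hgz := hg z
  rw [Scheme.IdealSheafData.mem_support_iff_of_mem (U := ⟨V, hV⟩) hzV, hC ⟨V, hV⟩ hVU,
    Scheme.zeroLocus_span, Scheme.zeroLocus_singleton, Set.mem_compl_iff, not_not] at hgz
  have hgz' : g z ∈ T.basicOpen a := ((T.basicOpen_res a (homOfLE hVU).op).le hgz).2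
  exact (Scheme.basicOpen_appLE g _ _ hW _).ge ⟨hz, hgz'⟩

lemma inter_support_nonempty_of_memLinearSystem {T : Scheme.{u}} (f : T ⟶ ProjSpace k N)
    [IsClosedImmersion f] {e : ℤ} (he : 0 < e) {C : T.IdealSheafData} (hC : MemLinearSystem f e C)
    {W : Closeds T} (hW : IsIrreducible (W : Set T)) (hdim : topologicalKrullDim (W : Set T) ≠ 0) :
    ((W : Set T) ∩ C.support).Nonempty := by
  by_contra hempty
  have hI := isIntegral_reducedScheme hW
  obtain ⟨s, -, hsC⟩ := hC
  have hdisj (z) : reducedι W z ∉ C.support := fun h ↦ hempty ⟨_, reducedι_mem W z, h⟩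
  refine hdim ?_
  rw [← range_reducedι W, topologicalKrullDim_range (reducedι W).isClosedEmbedding.isEmbedding]
  exact (isTwistSection_appLE (reducedι W) f he.le s).topologicalKrullDim_eq_zero (by omega)
    fun j ↦ isUnit_appLE_of_notMem_support _ (hsC j) hdisj _

lemma residualIntersection_inter_nonempty {X : Scheme.{u}} [IsNoetherian X] {Y : Closeds X}
    (i : X ⟶ ProjSpace k N) [IsClosedImmersion i] {n : ℕ} (hn : n ≠ 0)
    (hF : Nonempty (residualIntersection Y).subscheme)
    (hdim : IsPureDim (residualIntersection Y).subscheme n) {e : ℤ} (he : 0 < e)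
    {C : (reducedScheme Y).IdealSheafData} (hC : MemLinearSystem (reducedι Y ≫ i) e C) :
    (((residualIntersection Y).support : Set X) ∩ Set.range (divisorι Y C)).Nonempty := by
  obtain ⟨z⟩ := hF
  let φ := (residualIntersection Y).subschemeι
  let W := irreducibleComponent z
  have hWd := hdim W (irreducibleComponent_mem_irreducibleComponents z)
  have hφ := φ.isClosedEmbedding
  have hι := (reducedι Y).isClosedEmbedding
  have hWF : φ '' W ⊆ Set.range φ := Set.image_subset_range _ _
  have hWY : φ '' W ⊆ Set.range (reducedι Y) := by
    rw [range_reducedι]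
    exact hWF.trans (range_subschemeι_residualIntersection.le.trans Set.inter_subset_left)
  let S : Closeds (reducedScheme Y) := ⟨reducedι Y ⁻¹' (φ '' W),
    (hφ.isClosedMap _ isClosed_irreducibleComponent).preimage hι.continuous⟩
  have hS : reducedι Y '' S = φ '' W := Set.image_preimage_eq_of_subset hWY
  have hSirr : IsIrreducible (S : Set (reducedScheme Y)) := by
    rw [← isIrreducible_image_iff hι.isEmbedding, hS, isIrreducible_image_iff hφ.isEmbedding]
    exact isIrreducible_irreducibleComponent
  have hSdim : topologicalKrullDim (S : Set (reducedScheme Y)) = n := by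
    rw [← topologicalKrullDim_image hι.isEmbedding, hS, topologicalKrullDim_image hφ.isEmbedding,
      hWd]
  obtain ⟨t, htS, htC⟩ := inter_support_nonempty_of_memLinearSystem (reducedι Y ≫ i) he hC hSirr
    (hSdim ▸ Nat.cast_ne_zero.2 hn)
  rw [← Scheme.IdealSheafData.range_subschemeι, range_divisorι]
  exact ⟨reducedι Y t, hWF htS, t, htC, rfl⟩

end Meet

section Main

variable {k : Type u} [Field k] {N : ℕ} {X : Scheme.{u}} {Y : Closeds X}

lemma isNoetherian_of_isClosedImmersion (i : X ⟶ ProjSpace k N) [IsClosedImmersion i] :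
    IsNoetherian X where
  toIsLocallyNoetherian := LocallyOfFiniteType.isLocallyNoetherian (i ≫ projToSpec k N)
  toCompactSpace := QuasiCompact.compactSpace_of_compactSpace (i ≫ projToSpec k N)

lemma nonLocallyFreeLocus_eq_range [IsLocallyNoetherian X] (i : X ⟶ ProjSpace k N)
    (hY : IsIrreducible (Y : Set X)) (hm : ¬ HasMultiplicityOne Y) {e : ℤ} (he : 0 ≤ e)
    {C : (reducedScheme Y).IdealSheafData} (hC : MemLinearSystem (reducedι Y ≫ i) e C) :
    nonLocallyFreeLocus Y C = Set.range (divisorι Y C) := by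
  refine (nonLocallyFreeLocus_subset_range C).antisymm fun p hp ↦
    ⟨range_divisorι_subset C hp, fun hfree ↦ hm ?_⟩
  obtain ⟨V, hpV, hV⟩ := exists_ideal_eq_bot_of_isLocallyFreeAt i hY he hC hp hfree
  exact hasMultiplicityOne_of_ideal_eq_bot hV (range_divisorι_subset C hp) hpV

lemma eq_of_nonLocallyFreeLocus_eq [IsLocallyNoetherian X] (i : X ⟶ ProjSpace k N)
    (hY : IsIrreducible (Y : Set X)) (hm : ¬ HasMultiplicityOne Y) {e : ℤ} (he : 0 ≤ e)
    {C₁ C₂ : (reducedScheme Y).IdealSheafData} [IsReduced C₁.subscheme] [IsReduced C₂.subscheme]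
    (hC₁ : MemLinearSystem (reducedι Y ≫ i) e C₁) (hC₂ : MemLinearSystem (reducedι Y ≫ i) e C₂)
    (h : nonLocallyFreeLocus Y C₁ = nonLocallyFreeLocus Y C₂) : C₁ = C₂ := by
  rw [nonLocallyFreeLocus_eq_range i hY hm he hC₁,
    nonLocallyFreeLocus_eq_range i hY hm he hC₂] at h
  exact eq_of_range_divisorι_eq h

end Main

end

end ACM

theorem proposition5_general {k : Type u} [Field k] (N n : ℕ) (hn : 2 ≤ n) (X : Scheme.{u})
    [PreconnectedSpace X] (i : X ⟶ ACM.ProjSpace k N) [IsClosedImmersion i]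
    (hdim : ACM.IsPureDim X n) (hCM : ACM.IsCohenMacaulay X)
    (Y : Closeds X) (hY : (Y : Set X) ∈ irreducibleComponents X) (e : ℤ) (he : 0 < e) :
    (¬ ACM.HasMultiplicityOne Y →
      (∀ C : (ACM.reducedScheme Y).IdealSheafData, ACM.MemLinearSystem (ACM.reducedι Y ≫ i) e C →
        ACM.nonLocallyFreeLocus Y C = Set.range (ACM.divisorι Y C)) ∧
      (∀ C₁ C₂ : (ACM.reducedScheme Y).IdealSheafData,
        IsReduced C₁.subscheme → ACM.MemLinearSystem (ACM.reducedι Y ≫ i) e C₁ →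
        IsReduced C₂.subscheme → ACM.MemLinearSystem (ACM.reducedι Y ≫ i) e C₂ →
          (Nonempty (ACM.idealModule (ACM.divisorι Y C₁) ≅ ACM.idealModule (ACM.divisorι Y C₂)) ↔
            C₁ = C₂))) ∧
    (ACM.HasMultiplicityOne Y → ¬ IsIntegral X →
      Nonempty (ACM.residualIntersection Y).subscheme ∧
      ACM.IsPureDim (ACM.residualIntersection Y).subscheme (n - 1) ∧
      ∀ C : (ACM.reducedScheme Y).IdealSheafData, ACM.MemLinearSystem (ACM.reducedι Y ≫ i) e C →
        (((ACM.residualIntersection Y).support : Set X) ∩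
          Set.range (ACM.divisorι Y C)).Nonempty ∧
        ACM.nonLocallyFreeLocus Y C =
          ((ACM.residualIntersection Y).support : Set X) ∩ Set.range (ACM.divisorι Y C)) ∧
    (∀ C₁ C₂ : (ACM.reducedScheme Y).IdealSheafData,
      (Nonempty (ACM.idealModule (ACM.divisorι Y C₁) ≅ ACM.idealModule (ACM.divisorι Y C₂)) →
        ACM.nonLocallyFreeLocus Y C₁ = ACM.nonLocallyFreeLocus Y C₂) ∧
      (¬ ACM.HasMultiplicityOne Y →
        IsReduced C₁.subscheme → ACM.MemLinearSystem (ACM.reducedι Y ≫ i) e C₁ →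
        IsReduced C₂.subscheme → ACM.MemLinearSystem (ACM.reducedι Y ≫ i) e C₂ →
          ACM.nonLocallyFreeLocus Y C₁ = ACM.nonLocallyFreeLocus Y C₂ →
          Nonempty (ACM.idealModule (ACM.divisorι Y C₁) ≅
            ACM.idealModule (ACM.divisorι Y C₂)))) := by
  have := ACM.isNoetherian_of_isClosedImmersion i
  refine ⟨fun hm ↦ ⟨fun C hC ↦ ACM.nonLocallyFreeLocus_eq_range i hY.1 hm he.le hC,
    fun C₁ C₂ _ hC₁ _ hC₂ ↦ ⟨fun ⟨φ⟩ ↦ ?_, ?_⟩⟩, fun hm hX ↦ ?_,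
    fun C₁ C₂ ↦ ⟨fun ⟨φ⟩ ↦ ACM.nonLocallyFreeLocus_eq_of_iso φ, fun hm _ hC₁ _ hC₂ h ↦ ?_⟩⟩
  · exact ACM.eq_of_nonLocallyFreeLocus_eq i hY.1 hm he.le hC₁ hC₂
      (ACM.nonLocallyFreeLocus_eq_of_iso φ)
  · rintro rfl
    exact ⟨Iso.refl _⟩
  · have hF := ACM.nonempty_residualIntersection hY.1.nonempty
      fun h ↦ hX (ACM.isIntegral_of_eq_univ hCM hY.1 hm h)
    have hFdim : ACM.IsPureDim (ACM.residualIntersection Y).subscheme (n - 1) :=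
      ACM.isPureDim_residualIntersection (i ≫ ACM.projToSpec k N) hCM hY
        (by rw [hdim _ hY, Nat.sub_add_cancel (by omega)])
    exact ⟨hF, hFdim, fun C hC ↦
      ⟨ACM.residualIntersection_inter_nonempty i (by omega) hF hFdim he hC,
        ACM.nonLocallyFreeLocus_eq i hCM hY.1 hm he.le hC⟩⟩
  · obtain rfl := ACM.eq_of_nonLocallyFreeLocus_eq i hY.1 hm he.le hC₁ hC₂ h
    exact ⟨Iso.refl _⟩

theorem proposition5 {k : Type u} [Field k] [IsAlgClosed k] [CharZero k] (N n : ℕ) (hn : 2 ≤ n)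
    (X : Scheme.{u}) (i : X ⟶ ACM.ProjSpace k N) [IsClosedImmersion i]
    (hdim : ACM.IsPureDim X n) (hCM : ACM.IsCohenMacaulay X) (hacm : ACM.HasACMVanishing i n)
    (Y : Closeds X) (hY : (Y : Set X) ∈ irreducibleComponents X) (e : ℤ) (he : 0 < e) :
    (¬ ACM.HasMultiplicityOne Y →
      (∀ C : (ACM.reducedScheme Y).IdealSheafData,
        IsIntegral C.subscheme → ACM.MemLinearSystem (ACM.reducedι Y ≫ i) e C →
          ACM.nonLocallyFreeLocus Y C = Set.range (ACM.divisorι Y C)) ∧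
      (∀ C₁ C₂ : (ACM.reducedScheme Y).IdealSheafData,
        IsIntegral C₁.subscheme → ACM.MemLinearSystem (ACM.reducedι Y ≫ i) e C₁ →
        IsIntegral C₂.subscheme → ACM.MemLinearSystem (ACM.reducedι Y ≫ i) e C₂ →
          (Nonempty (ACM.idealModule (ACM.divisorι Y C₁) ≅ ACM.idealModule (ACM.divisorι Y C₂)) ↔
            C₁ = C₂))) ∧
    (ACM.HasMultiplicityOne Y → ¬ IsIntegral X →
      Nonempty (ACM.residualIntersection Y).subscheme ∧
      ACM.IsPureDim (ACM.residualIntersection Y).subscheme (n - 1) ∧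
      ∀ C : (ACM.reducedScheme Y).IdealSheafData,
        IsIntegral C.subscheme → ACM.MemLinearSystem (ACM.reducedι Y ≫ i) e C →
          (((ACM.residualIntersection Y).support : Set X) ∩
            Set.range (ACM.divisorι Y C)).Nonempty ∧
          ACM.nonLocallyFreeLocus Y C =
            ((ACM.residualIntersection Y).support : Set X) ∩ Set.range (ACM.divisorι Y C)) ∧
    (∀ C₁ C₂ : (ACM.reducedScheme Y).IdealSheafData,
      IsIntegral C₁.subscheme → ACM.MemLinearSystem (ACM.reducedι Y ≫ i) e C₁ →
      IsIntegral C₂.subscheme → ACM.MemLinearSystem (ACM.reducedι Y ≫ i) e C₂ →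
        (Nonempty (ACM.idealModule (ACM.divisorι Y C₁) ≅ ACM.idealModule (ACM.divisorι Y C₂)) →
          ACM.nonLocallyFreeLocus Y C₁ = ACM.nonLocallyFreeLocus Y C₂) ∧
        (¬ ACM.HasMultiplicityOne Y →
          ACM.nonLocallyFreeLocus Y C₁ = ACM.nonLocallyFreeLocus Y C₂ →
          Nonempty (ACM.idealModule (ACM.divisorι Y C₁) ≅
            ACM.idealModule (ACM.divisorι Y C₂)))) := by
  have := ACM.preconnectedSpace_of_hasACMVanishing i hn hacm
  obtain ⟨h₁, h₂, h₃⟩ := proposition5_general N n hn X i hdim hCM Y hY e he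
  exact ⟨fun hm ↦ ⟨fun C _ ↦ (h₁ hm).1 C, fun C₁ C₂ _ hC₁ _ hC₂ ↦
      (h₁ hm).2 C₁ C₂ inferInstance hC₁ inferInstance hC₂⟩,
    fun hm hX ↦ ⟨(h₂ hm hX).1, (h₂ hm hX).2.1, fun C _ ↦ (h₂ hm hX).2.2 C⟩,
    fun C₁ C₂ _ hC₁ _ hC₂ ↦ ⟨(h₃ C₁ C₂).1, fun hm ↦
      (h₃ C₁ C₂).2 hm inferInstance hC₁ inferInstance hC₂⟩⟩
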